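/- **Setting.** Identify $\mathbb R^2\cong\mathbb C$. Let $\Lambda=\mathbb Z^2$ or $\Lambda=A_{\rm tri}\mathbb Z^2$ with $A_{\rm tri}=\begin{pmatrix}1&1/2\\0&\sqrt3/2\end{pmatrix}$, and let $Q_\Lambda$ be the rotation by $\pi/2$, respectively $2\pi/3$. Let $\mathcal R\subset\Lambda\setminus\{0\}$ be finite with $\operatorname{span}_{\mathbb Z}\mathcal R=\Lambda$, and write $Du(x)=(u(x+\rho)-u(x))_{\rho\in\mathcal R}$ for $u:\Lambda\to\mathbb R$. Let $V\in C^6(\mathbb R^{\mathcal R})$ be such that * $Q_\Lambda\mathcal R=\mathcal R$ and $V(A)=V((A_{Q_\Lambda\rho})_{\rho\in\mathcal R})$ for all $A$; * there is a minimal $p>0$ with $V(A+p\,(\delta_{\rho\sigma})_{\sigma\in\mathcal R})=V(A)$ for all $A$ and all $\rho\in\mathcal R$; * (lattice stability) there is $c_0>0$ with $\sum_{x\in\Lambda}\nabla^2V(0)[Du(x),Du(x)]\ge c_0\|u\|_{\dot{\mathcal H}^1}^2$ for all $u\in\dot{\mathcal H}^1$. Here $\dot{\mathcal H}^1=\{u:\Lambda\to\mathbb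 R\mid Du\in\ell^2(\Lambda)\}/\mathbb R$ with $\|u\|_{\dot{\mathcal H}^1}=\big(\sum_{x\in\Lambda}|Du(x)|^2\big)^{1/2}$. Let $\mathcal H^c$ be the set of functions $\Lambda\to\mathbb R$ with bounded support and, for $\Omega\subset\Lambda$, let $\mathcal H^0(\Omega)=\{v\in\mathcal H^c\mid v=0\text{ on }\Lambda\setminus\Omega\}$. Let $b\in\{p,-p\}$, let $\hat x\in\mathbb R^2\setminus\Lambda$, and let $\hat u(x)=\frac{b}{2\pi}\arg(x-\hat x)$ with $\arg\in[0,2\pi)$. For $u_{\rm pred}\in\hat u+\dot{\mathcal H}^1$ let $\mathcal E(u_{\rm pred};\cdot):\dot{\mathcal H}^1\to\mathbb R$ be the continuous extension of $$\mathcal E(u_{\rm pred};u)=\sum_{x\in\Lambda}\Big(V\big(Du_{\rm pred}(x)+Du(x)\big)-V\big(Du_{\rm pred}(x)\big)\Big),\qquad u\in\mathcal H^c,$$ and write $\delta_u^2\mathcal E(u_{\rm pred};u)[v,v]=\frac{d^2}{dt^2}\big|_{t=0}\mathcal E(u_{\rm pred};u+tv)$. **Theorem 3.1.** Let $\tilde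 u\in\dot{\mathcal H}^1$ be a strongly stable solution of the predictor–corrector problem, that is, a local minimiser of $\mathcal E(u_{\rm pred};\cdot)$ on $\dot{\mathcal H}^1$ for which there is $c_1>0$ with $$\delta_u^2\mathcal E(u_{\rm pred};\tilde u)[v,v]\ge c_1\|v\|_{\dot{\mathcal H}^1}^2\qquad\text{for all }v\in\mathcal H^c.$$ Suppose that there are $s>1$, $r\in\{0,1\}$ and a constant $C_0$ such that $|D\tilde u(x)|\le C_0|x|^{-s}\log^r|x|$ for all $x\in\Lambda$ with $|x|$ large enough. Then there exist $C,R_0,c>0$ such that for every $R>R_0$ and every finite $\Omega_R$ with $B_R\cap\Lambda\subset\Omega_R\subset\Lambda$, where $B_R=\{|x|<R\}$, there is a stable supercell solution $\tilde u_R\in\mathcal H^0(\Omega_R)$, that is, a local minimiser of $\mathcal E(u_{\rm pred};\cdot)$ on $\mathcal H^0(\Omega_R)$ (in the topology of $\dot{\mathcal H}^1$) with $$\delta_u^2\mathcal E(u_{\rm pred};\tilde u_R)[v,v]\ge c\,\|v\|_{\dot{\mathcal H}^1}^2\qquad\text{for all }v\in\mathcal H^0(\Omega_R),$$ and it satisfies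 $$\|\tilde u_R-\tilde u\|_{\dot{\mathcal H}^1}\le C\,R^{1-s}\log^r R.$$ -/

import Mathlib

open Filter Topology Set

noncomputable section

namespace ScrewDislocation

/-! The plane is identified with the complex numbers, with the Euclidean norm. -/

/-- The two planar Bravais lattices under consideration. -/
inductive LatticeKind
  | square
  | triangular

/-- The second column of the lattice matrix; the first one is `1`. -/
def LatticeKind.tau : LatticeKind → ℂ
  | .square => ⟨0, 1⟩
  | .triangular => ⟨1 / 2, Real.sqrt 3 / 2⟩

/-- The rotation by `π / 2` (square) or `2 π / 3` (triangular), as a complex factor. -/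
def LatticeKind.rot : LatticeKind → ℂ
  | .square => ⟨0, 1⟩
  | .triangular => ⟨-1 / 2, Real.sqrt 3 / 2⟩

/-- The lattice: all integer combinations of `1` and `tau`. -/
def lattice (k : LatticeKind) : AddSubgroup ℂ where
  carrier := {z | ∃ m n : ℤ, z = (m : ℂ) + (n : ℂ) * k.tau}
  zero_mem' := ⟨0, 0, by simp⟩
  add_mem' := by
    rintro _ _ ⟨m, n, rfl⟩ ⟨m', n', rfl⟩
    exact ⟨m + m', n + n', by push_cast; ring⟩
  neg_mem' := by
    rintro _ ⟨m, n, rfl⟩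
    exact ⟨-m, -n, by push_cast; ring⟩

/-- Lattice sites. -/
abbrev Site (k : LatticeKind) : Type := ↥(lattice k)

variable {k : LatticeKind}

/-- The discrete gradient `(u (x + ρ) - u x)` for `ρ ∈ R`, with the Euclidean norm. -/
def grad (R : Finset (Site k)) (u : Site k → ℝ) (x : Site k) : EuclideanSpace ℝ R :=
  WithLp.toLp 2 fun ρ => u (x + ρ) - u x

theorem grad_add (R : Finset (Site k)) (u v : Site k → ℝ) :
    grad R (u + v) = grad R u + grad R v := by
  funext x; ext ρ; simp [grad]; ring

theorem grad_smul (R : Finset (Site k)) (c : ℝ) (u : Site k → ℝ) :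
    grad R (c • u) = c • grad R u := by
  funext x; ext ρ; simp [grad]; ring

/-- The displacements with square-summable discrete gradient. -/
def h1Submodule (R : Finset (Site k)) : Submodule ℝ (Site k → ℝ) where
  carrier := {u | Memℓp (grad R u) 2}
  zero_mem' := by
    have h : grad R (0 : Site k → ℝ) = 0 := by funext x; ext ρ; simp [grad]
    simpa [h] using (zero_memℓp (E := fun _ : Site k => EuclideanSpace ℝ R) (p := 2))
  add_mem' := by
    intro u v hu hv
    have := Memℓp.add hu hv
    simpa [grad_add] using this
  smul_mem' := by
    intro c u hu
    have := Memℓp.const_smul hu c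
    simpa [grad_smul] using this

/-- The energy space of displacements with square-summable discrete gradient. Its seminorm is
the `ℓ²` norm of the discrete gradient (see `HDot.norm_def`) and vanishes exactly on the
constants. Elements are representatives: convergence, local minimality, the norm and the energy
below depend only on the classes modulo constants. -/
def HDot (R : Finset (Site k)) : Type := ↥(h1Submodule R)

instance (R : Finset (Site k)) : AddCommGroup (HDot R) :=
  inferInstanceAs (AddCommGroup ↥(h1Submodule R))

instance (R : Finset (Site k)) : Module ℝ (HDot R) :=
  inferInstanceAs (Module ℝ ↥(h1Submodule R))

instance (R : Finset (Site k)) : CoeFun (HDot R) (fun _ => Site k → ℝ) := ⟨fun u => u.1⟩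

/-- The discrete gradient as a linear map into `ℓ²`. -/
def gradL (R : Finset (Site k)) :
    HDot R →ₗ[ℝ] lp (fun _ : Site k => EuclideanSpace ℝ R) 2 where
  toFun u := ⟨grad R u, u.2⟩
  map_add' u v := Subtype.ext (grad_add R u.1 v.1)
  map_smul' c u := Subtype.ext (grad_smul R c u.1)

instance (R : Finset (Site k)) : SeminormedAddCommGroup (HDot R) :=
  SeminormedAddCommGroup.induced (HDot R) (lp (fun _ : Site k => EuclideanSpace ℝ R) 2) (gradL R)

instance (R : Finset (Site k)) : NormedSpace ℝ (HDot R) :=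
  NormedSpace.induced ℝ (HDot R) (lp (fun _ : Site k => EuclideanSpace ℝ R) 2) (gradL R)

theorem HDot.norm_def (R : Finset (Site k)) (u : HDot R) :
    ‖u‖ = Real.sqrt (∑' x, ‖grad R u x‖ ^ 2) := by
  have h : ‖u‖ = ‖gradL R u‖ := rfl
  rw [h, lp.norm_eq_tsum_rpow (by norm_num), Real.sqrt_eq_rpow]
  simp [gradL]

/-- The space of compactly (that is, finitely) supported displacements. -/
def Hc (R : Finset (Site k)) : Set (HDot R) := {v | (Function.support (v : Site k → ℝ)).Finite}

/-- The Galerkin space: compactly supported displacements that vanish outside `Ω`. -/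
def H0 (R : Finset (Site k)) (Ω : Set (Site k)) : Set (HDot R) :=
  {v | v ∈ Hc R ∧ ∀ x ∉ Ω, v x = 0}

/-- The argument in `[0, 2 π)`: its branch cut is the half-line of nonnegative reals. -/
def argCut (z : ℂ) : ℝ := toIcoMod Real.two_pi_pos 0 z.arg

/-- The far-field predictor of a screw dislocation with core `xhat` and Burgers vector `b`. -/
def uHat (b : ℝ) (xhat : ℂ) (x : Site k) : ℝ := b / (2 * Real.pi) * argCut ((x : ℂ) - xhat)

/-- The energy difference for compactly supported `u` (the sum then has finitely many nonzero
terms). -/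
def energyC (R : Finset (Site k)) (V : EuclideanSpace ℝ R → ℝ) (uPred : Site k → ℝ)
    (u : HDot R) : ℝ :=
  ∑' x, (V (grad R uPred x + grad R u x) - V (grad R uPred x))

/-- The energy difference functional on the whole energy space: the extension by continuity
from the compactly supported displacements. -/
def energy (R : Finset (Site k)) (V : EuclideanSpace ℝ R → ℝ) (uPred : Site k → ℝ) :
    HDot R → ℝ :=
  extendFrom (Hc R) (energyC R V uPred)

/-- The second variation `δ²E(u)[v, v]` of a functional. -/
def secondVariation {R : Finset (Site k)} (E : HDot R → ℝ) (u v : HDot R) : ℝ :=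
  iteratedDeriv 2 (fun t : ℝ => E (u + t • v)) 0

/-- `V` is invariant under shifting any single strain component by `q`. -/
def IsSlipPeriod (R : Finset (Site k)) (V : EuclideanSpace ℝ R → ℝ) (q : ℝ) : Prop :=
  open scoped Classical in
  ∀ (A : EuclideanSpace ℝ R) (ρ : R), V (A + EuclideanSpace.single ρ q) = V A

/-- The standing assumptions on the interaction range `R`, the site potential `V`, the Burgers
vector `b` and the dislocation core `xhat`. -/
structure IsScrewModel (R : Finset (Site k)) (V : EuclideanSpace ℝ R → ℝ) (b : ℝ)
    (xhat : ℂ) : Prop where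
  zero_notMem : (0 : Site k) ∉ R
  span_eq_top : AddSubgroup.closure (R : Set (Site k)) = ⊤
  contDiff : ContDiff ℝ 6 V
  /-- `R` is mapped onto itself by the lattice rotation, and `V` is invariant under it. -/
  rotation : ∃ π : Equiv.Perm R, (∀ ρ : R, ((π ρ : Site k) : ℂ) = k.rot * ((ρ : Site k) : ℂ)) ∧
    ∀ A : EuclideanSpace ℝ R, V A = V (WithLp.toLp 2 fun ρ => A (π ρ))
  /-- The Burgers vector is plus or minus the minimal slip period of `V`. -/
  burgers : ∃ p : ℝ, IsLeast {q : ℝ | 0 < q ∧ IsSlipPeriod R V q} p ∧ (b = p ∨ b = -p)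
  /-- Lattice (phonon) stability. -/
  latticeStable : ∃ c₀ : ℝ, 0 < c₀ ∧ ∀ u : HDot R,
    c₀ * ‖u‖ ^ 2 ≤ ∑' x, iteratedFDeriv ℝ 2 V 0 ![grad R u x, grad R u x]
  core_notMem : xhat ∉ lattice k

end ScrewDislocation

end

noncomputable section

namespace ScrewDislocation

variable {k : LatticeKind}

/-! ### Taylor estimates for maps with bounded derivatives -/

section Taylor

variable {F G : Type*} [NormedAddCommGroup F] [NormedSpace ℝ F] [NormedAddCommGroup G]
  [NormedSpace ℝ G]

/-! The proof is a Galerkin argument: truncate `u` to a compactly supported `a` close to it, then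
find a local minimiser near `a` by direct minimisation. No inverse function theorem is used.

Periodicity of `V` in each strain component makes its second derivative bounded and Lipschitz on the
whole strain space (`exists_taylorBounds`). Subtracting the linear term at the predictor therefore
leaves a density of quadratic order, summable for every strain in `ℓ²`, and the energy becomes a
functional `L u + remainder` with uniform Taylor estimates (`extEnergy`). It agrees with the given
energy on the closure of the compactly supported displacements.

The delicate point is that the first variation `L` at the predictor is bounded in the energy norm
(`exists_firstVariation`), since the predictor strain decays only like `1 / |z|` and is not in `ℓ²`.
Slip invariance removes the branch cut from the stress. Forces are then computed modulo bounded
ones, so stresses matter only modulo `ℓ²`, and only the linear stresses `Im (a_σ / z)` survive. In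
this quotient the bond divergence is additive in the bond direction and reduces to the two
generators of the lattice. Rotational symmetry and symmetry of the Hessian fix the two remaining
coefficients so that the residual is a multiple of a difference of two mixed second differences of
`log |z|`, and these coincide.

For the truncation (`exists_truncation`), subtract from `u` its value at one site of an annulus of
size comparable to `ρ` and multiply by a cutoff. On the annulus the oscillation of `u` is at most
its size times the largest strain, so the cutoff costs no more than the `ℓ²` tail of the strain,
namely `ρ ^ (1 - s) * log ρ ^ r`.

In `exists_galerkin_minimiser` the energy is minimised over a closed ball about `a` in the
finite-dimensional space. Strong stability makes the energy on the bounding sphere exceed its value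
at `a`, so the minimiser is interior, and its distance to `u` is a constant times the truncation
error. -/

theorem norm_sub_le_of_norm_fderiv_le {f : F → G} (hf : Differentiable ℝ f) {M : ℝ}
    (hM : ∀ A, ‖fderiv ℝ f A‖ ≤ M) (A B : F) : ‖f (A + B) - f A‖ ≤ M * ‖B‖ := by
  have := convex_univ.norm_image_sub_le_of_norm_fderiv_le (𝕜 := ℝ) (f := f) (C := M)
    (fun x _ => hf x) (fun x _ => hM x) (mem_univ A) (mem_univ (A + B))
  simpa using this

/-- Mean value inequality for `f (A + C) - f' A C` on the ball of radius `‖B‖`. The sharp factor `1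
/ 2` is not needed. -/
theorem norm_taylor_one_le {f : F → G} (hf : Differentiable ℝ f)
    {M : ℝ} (hM : ∀ A B, ‖fderiv ℝ f (A + B) - fderiv ℝ f A‖ ≤ M * ‖B‖) (hM0 : 0 ≤ M) (A B : F) :
    ‖f (A + B) - f A - fderiv ℝ f A B‖ ≤ M * ‖B‖ ^ 2 := by
  have hd : ∀ C : F, HasFDerivAt (fun C => f (A + C) - fderiv ℝ f A C)
      (fderiv ℝ f (A + C) - fderiv ℝ f A) C := by
    intro C
    have h1 : HasFDerivAt (fun C => f (A + C)) (fderiv ℝ f (A + C)) C := by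
      rw [hasFDerivAt_comp_add_left]; exact (hf _).hasFDerivAt
    exact h1.sub (fderiv ℝ f A).hasFDerivAt
  have := (convex_closedBall (0 : F) ‖B‖).norm_image_sub_le_of_norm_hasFDerivWithin_le
    (f := fun C => f (A + C) - fderiv ℝ f A C) (C := M * ‖B‖) (x := 0) (y := B)
    (fun x _ => (hd x).hasFDerivWithinAt)
    (fun x hx => (hM A x).trans (by
      gcongr; simpa using hx)) (by simp) (by simp)
  simp only [add_zero, map_zero, sub_zero] at this
  calc _ = ‖f (A + B) - fderiv ℝ f A B - f A‖ := by congr 1; abel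
    _ ≤ _ := this
    _ = _ := by ring

/-- After subtracting half the Hessian form, the derivative in `C` is the first-order Taylor error
of `f'`. Symmetry of the Hessian enters when the quadratic term is differentiated. -/
theorem norm_taylor_two_le {f : F → ℝ} (hf : ContDiff ℝ 2 f)
    {M : ℝ} (hM : ∀ A B, ‖fderiv ℝ (fderiv ℝ f) (A + B) - fderiv ℝ (fderiv ℝ f) A‖ ≤ M * ‖B‖)
    (hM0 : 0 ≤ M) (A B : F) :
    ‖f (A + B) - f A - fderiv ℝ f A B - 1 / 2 * fderiv ℝ (fderiv ℝ f) A B B‖ ≤ M * ‖B‖ ^ 3 := by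
  have hf1 : Differentiable ℝ f := hf.differentiable (by norm_num)
  have hf2 : Differentiable ℝ (fderiv ℝ f) :=
    (hf.fderiv_right (m := 1) (by norm_num)).differentiable (by norm_num)
  have hsymm : ∀ C D, fderiv ℝ (fderiv ℝ f) A C D = fderiv ℝ (fderiv ℝ f) A D C :=
    fun C D => (hf.contDiffAt.isSymmSndFDerivAt (by simp)).eq C D
  set H := fderiv ℝ (fderiv ℝ f) A with hH
  have hd : ∀ C : F, HasFDerivAt (fun C => f (A + C) - fderiv ℝ f A C - 1 / 2 * H C C)
      (fderiv ℝ f (A + C) - fderiv ℝ f A - H C) C := by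
    intro C
    have h1 : HasFDerivAt (fun C => f (A + C)) (fderiv ℝ f (A + C)) C := by
      rw [hasFDerivAt_comp_add_left]; exact (hf1 _).hasFDerivAt
    have h3 : HasFDerivAt (fun C => 1 / 2 * H C C) (H C) C := by
      have := (H.hasFDerivAt (x := C)).clm_apply (hasFDerivAt_id C)
      have := this.const_mul (1 / 2 : ℝ)
      refine this.congr_fderiv ?_
      ext D
      simp [hsymm D C]
      ring
    exact (h1.sub (fderiv ℝ f A).hasFDerivAt).sub h3
  have := (convex_closedBall (0 : F) ‖B‖).norm_image_sub_le_of_norm_hasFDerivWithin_le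
    (f := fun C => f (A + C) - fderiv ℝ f A C - 1 / 2 * H C C) (C := M * ‖B‖ ^ 2)
    (x := 0) (y := B)
    (fun x _ => (hd x).hasFDerivWithinAt)
    (fun x hx => (norm_taylor_one_le hf2 hM hM0 A x).trans (by
      have : ‖x‖ ≤ ‖B‖ := by simpa using hx
      gcongr)) (by simp) (by simp)
  simp only [add_zero, map_zero, sub_zero, mul_zero] at this
  calc _ = ‖f (A + B) - fderiv ℝ f A B - 1 / 2 * H B B - f A‖ := by congr 1; ring
    _ ≤ _ := this
    _ = _ := by ring

end Taylor

/-! ### Periodic potentials -/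

section Periodic

variable {R : Finset (Site k)} {G : Type*} [NormedAddCommGroup G]

/-- The lattice of strains whose components are integer multiples of `p`. -/
def slip (R : Finset (Site k)) (p : ℝ) (n : R → ℤ) : EuclideanSpace ℝ R :=
  WithLp.toLp 2 fun ρ => n ρ * p

theorem IsSlipPeriod.add_slip {V : EuclideanSpace ℝ R → ℝ} {p : ℝ} (h : IsSlipPeriod R V p)
    (n : R → ℤ) (A : EuclideanSpace ℝ R) : V (A + slip R p n) = V A := by
  classical
  let S : AddSubgroup (EuclideanSpace ℝ R) :=
    { carrier := {T | ∀ A, V (A + T) = V A}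
      zero_mem' := by simp
      add_mem' := by
        intro a b ha hb A
        rw [← add_assoc, hb, ha]
      neg_mem' := by
        intro a ha A
        rw [← ha (A + -a)]; simp }
  have h1 : ∀ ρ, EuclideanSpace.single ρ p ∈ S := by
    intro ρ A
    convert h A ρ
  have h2 : slip R p n = ∑ ρ, n ρ • EuclideanSpace.single ρ p := by
    ext σ
    simp [slip, Finset.sum_apply, Pi.single_apply]
  have h3 : slip R p n ∈ S := by
    rw [h2]
    exact sum_mem fun ρ _ => S.zsmul_mem (h1 ρ) _
  exact h3 A

theorem fderiv_add_slip [NormedSpace ℝ G] {f : EuclideanSpace ℝ R → G} {p : ℝ}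
    (h : ∀ n A, f (A + slip R p n) = f A) (n : R → ℤ) (A : EuclideanSpace ℝ R) :
    fderiv ℝ f (A + slip R p n) = fderiv ℝ f A := by
  rw [← fderiv_comp_add_right]
  congr 1
  funext B
  exact h n B

/-- Reducing every component modulo `p` brings any strain into the compact cube `[0, p]^R` without
changing `f`. -/
theorem exists_bound_of_slip {f : EuclideanSpace ℝ R → G} {p : ℝ} (hp : 0 < p)
    (h : ∀ n A, f (A + slip R p n) = f A) (hf : Continuous f) : ∃ M, ∀ A, ‖f A‖ ≤ M := by
  have hc : IsCompact (WithLp.toLp 2 '' (Set.univ.pi fun _ : R => Icc (0 : ℝ) p)) :=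
    (isCompact_univ_pi fun _ => isCompact_Icc).image (PiLp.continuous_toLp 2 _)
  obtain ⟨M, hM⟩ := hc.exists_bound_of_continuousOn hf.continuousOn
  refine ⟨M, fun A => ?_⟩
  have key : WithLp.toLp 2 (fun ρ => toIcoMod hp 0 (A ρ))
      + slip R p (fun ρ => toIcoDiv hp 0 (A ρ)) = A := by
    ext ρ
    simp [slip, ← zsmul_eq_mul]
  rw [← key, h]
  apply hM
  refine ⟨_, fun ρ _ => ?_, rfl⟩
  have := toIcoMod_mem_Ico hp 0 (A ρ)
  rw [zero_add] at this
  exact ⟨this.1, this.2.le⟩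

theorem exists_lip_of_slip [NormedSpace ℝ G] {f : EuclideanSpace ℝ R → G} {p : ℝ} (hp : 0 < p)
    (h : ∀ n A, f (A + slip R p n) = f A) (hf : ContDiff ℝ 1 f) :
    ∃ M, ∀ A B, ‖f (A + B) - f A‖ ≤ M * ‖B‖ := by
  obtain ⟨M, hM⟩ := exists_bound_of_slip hp (fderiv_add_slip h)
    (hf.continuous_fderiv (by norm_num))
  exact ⟨M, norm_sub_le_of_norm_fderiv_le (hf.differentiable (by norm_num)) hM⟩

end Periodic

/-- Uniform Taylor bounds of a potential. -/
structure TaylorBounds {F : Type*} [NormedAddCommGroup F] [NormedSpace ℝ F] (V : F → ℝ)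
    (M : ℝ) : Prop where
  contDiff : ContDiff ℝ 2 V
  pos : 0 < M
  hess_le : ∀ A, ‖fderiv ℝ (fderiv ℝ V) A‖ ≤ M
  hess_lip : ∀ A B, ‖fderiv ℝ (fderiv ℝ V) (A + B) - fderiv ℝ (fderiv ℝ V) A‖ ≤ M * ‖B‖

/-- Derivatives inherit the slip periods, so continuity of the second and third ones already gives
global bounds. The maximum with `1` only secures `0 < M`. -/
theorem exists_taylorBounds {R : Finset (Site k)} {V : EuclideanSpace ℝ R → ℝ}
    (hV : ContDiff ℝ 6 V) {p : ℝ} (hp : 0 < p) (h : IsSlipPeriod R V p) :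
    ∃ M, TaylorBounds V M := by
  have c1 : ContDiff ℝ 5 (fderiv ℝ V) := hV.fderiv_right (by norm_num)
  have c2 : ContDiff ℝ 4 (fderiv ℝ (fderiv ℝ V)) := c1.fderiv_right (by norm_num)
  have p2 := fderiv_add_slip (fderiv_add_slip h.add_slip)
  obtain ⟨M₂, h₂⟩ := exists_bound_of_slip hp p2 c2.continuous
  obtain ⟨M₃, h₃⟩ := exists_lip_of_slip hp p2 (c2.of_le (by norm_num))
  refine ⟨max (max M₂ M₃) 1, hV.of_le (by norm_num), by positivity, fun A => ?_, fun A B => ?_⟩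
  · exact (h₂ A).trans (by simp)
  · refine (h₃ A B).trans ?_
    gcongr
    simp

namespace TaylorBounds

variable {F : Type*} [NormedAddCommGroup F] [NormedSpace ℝ F] {V : F → ℝ} {M : ℝ}

theorem differentiable (h : TaylorBounds V M) : Differentiable ℝ V :=
  h.contDiff.differentiable (by norm_num)

theorem differentiable_fderiv (h : TaylorBounds V M) : Differentiable ℝ (fderiv ℝ V) :=
  (h.contDiff.fderiv_right (m := 1) (by norm_num)).differentiable (by norm_num)

theorem fderiv_lip (h : TaylorBounds V M) (A B : F) :
    ‖fderiv ℝ V (A + B) - fderiv ℝ V A‖ ≤ M * ‖B‖ :=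
  norm_sub_le_of_norm_fderiv_le h.differentiable_fderiv h.hess_le A B

theorem taylor_one (h : TaylorBounds V M) (A B : F) :
    ‖V (A + B) - V A - fderiv ℝ V A B‖ ≤ M * ‖B‖ ^ 2 :=
  norm_taylor_one_le h.differentiable h.fderiv_lip h.pos.le A B

theorem fderiv_taylor_one (h : TaylorBounds V M) (A B : F) :
    ‖fderiv ℝ V (A + B) - fderiv ℝ V A - fderiv ℝ (fderiv ℝ V) A B‖ ≤ M * ‖B‖ ^ 2 :=
  norm_taylor_one_le h.differentiable_fderiv h.hess_lip h.pos.le A B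

theorem taylor_two (h : TaylorBounds V M) (A B : F) :
    ‖V (A + B) - V A - fderiv ℝ V A B - 1 / 2 * fderiv ℝ (fderiv ℝ V) A B B‖ ≤ M * ‖B‖ ^ 3 :=
  norm_taylor_two_le h.contDiff h.hess_lip h.pos.le A B

end TaylorBounds

/-! ### Square-summable families -/

section SquareSummable

variable {ι F G : Type*} [NormedAddCommGroup F] [NormedAddCommGroup G]

theorem lp_summable_sq (h : lp (fun _ : ι => F) 2) : Summable fun x => ‖h x‖ ^ 2 := by
  simpa using (lp.memℓp h).summable (by norm_num)

theorem lp_tsum_sq (h : lp (fun _ : ι => F) 2) : ∑' x, ‖h x‖ ^ 2 = ‖h‖ ^ 2 := by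
  simpa using (lp.norm_rpow_eq_tsum (p := 2) (by norm_num) h).symm

theorem lp_summable_mul (h : lp (fun _ : ι => F) 2) (l : lp (fun _ : ι => G) 2) :
    Summable fun x => ‖h x‖ * ‖l x‖ := by
  refine Summable.of_nonneg_of_le (fun x => by positivity) (fun x => ?_)
    ((lp_summable_sq h).add (lp_summable_sq l))
  nlinarith [sq_nonneg (‖h x‖ - ‖l x‖), sq_nonneg ‖h x‖, sq_nonneg ‖l x‖]

theorem lp_tsum_mul_le (h : lp (fun _ : ι => F) 2) (l : lp (fun _ : ι => G) 2) :
    ∑' x, ‖h x‖ * ‖l x‖ ≤ ‖h‖ * ‖l‖ := by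
  refine (lp_summable_mul h l).tsum_le_of_sum_le fun s => ?_
  have := Finset.sum_mul_sq_le_sq_mul_sq s (fun x => ‖h x‖) (fun x => ‖l x‖)
  have h1 : ∑ x ∈ s, ‖h x‖ ^ 2 ≤ ‖h‖ ^ 2 := by
    rw [← lp_tsum_sq]; exact (lp_summable_sq h).sum_le_tsum _ (fun _ _ => by positivity)
  have h2 : ∑ x ∈ s, ‖l x‖ ^ 2 ≤ ‖l‖ ^ 2 := by
    rw [← lp_tsum_sq]; exact (lp_summable_sq l).sum_le_tsum _ (fun _ _ => by positivity)
  refine le_of_sq_le_sq (this.trans ?_) (by positivity)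
  rw [mul_pow]
  gcongr

theorem summable_of_le_mul {f : ι → ℝ} {C : ℝ} (h : lp (fun _ : ι => F) 2)
    (l : lp (fun _ : ι => G) 2) (hf : ∀ x, ‖f x‖ ≤ C * (‖h x‖ * ‖l x‖)) : Summable f :=
  Summable.of_norm_bounded ((lp_summable_mul h l).mul_left C) hf

theorem norm_tsum_le_of_le_mul {f : ι → ℝ} {C : ℝ} (hC : 0 ≤ C) (h : lp (fun _ : ι => F) 2)
    (l : lp (fun _ : ι => G) 2) (hf : ∀ x, ‖f x‖ ≤ C * (‖h x‖ * ‖l x‖)) :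
    ‖∑' x, f x‖ ≤ C * (‖h‖ * ‖l‖) := by
  refine (tsum_of_norm_bounded ((lp_summable_mul h l).mul_left C).hasSum hf).trans ?_
  rw [tsum_mul_left]
  exact mul_le_mul_of_nonneg_left (lp_tsum_mul_le h l) hC

end SquareSummable

/-! ### The nonlinear part of the energy on `ℓ²` -/

section Nonlinear

variable {ι F : Type*} [NormedAddCommGroup F] [NormedSpace ℝ F] (V : F → ℝ) (g : ι → F)

/-- The energy density minus its linearization, summed over all sites. -/
def remainder (h : lp (fun _ : ι => F) 2) : ℝ :=
  ∑' x, (V (g x + h x) - V (g x) - fderiv ℝ V (g x) (h x))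

/-- The first variation of `remainder`. -/
def remainderD (h l : lp (fun _ : ι => F) 2) : ℝ :=
  ∑' x, (fderiv ℝ V (g x + h x) (l x) - fderiv ℝ V (g x) (l x))

/-- The second variation of `remainder`. -/
def remainderH (h l m : lp (fun _ : ι => F) 2) : ℝ :=
  ∑' x, fderiv ℝ (fderiv ℝ V) (g x + h x) (l x) (m x)

variable {V} {M : ℝ}

theorem summable_remainder (hV : TaylorBounds V M) (h : lp (fun _ : ι => F) 2) :
    Summable fun x => V (g x + h x) - V (g x) - fderiv ℝ V (g x) (h x) :=
  summable_of_le_mul h h (C := M) fun x => by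
    rw [← sq]; exact hV.taylor_one _ _

theorem norm_fderiv_sub_le (hV : TaylorBounds V M) (A B C : F) :
    ‖fderiv ℝ V (A + B) C - fderiv ℝ V A C‖ ≤ M * (‖B‖ * ‖C‖) := by
  rw [← sub_apply, ← mul_assoc]
  exact ContinuousLinearMap.le_of_opNorm_le _ (hV.fderiv_lip _ _) _

theorem summable_remainderD (hV : TaylorBounds V M) (h l : lp (fun _ : ι => F) 2) :
    Summable fun x => fderiv ℝ V (g x + h x) (l x) - fderiv ℝ V (g x) (l x) :=
  summable_of_le_mul h l fun _ => norm_fderiv_sub_le hV _ _ _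

theorem norm_remainderD_le (hV : TaylorBounds V M) (h l : lp (fun _ : ι => F) 2) :
    ‖remainderD V g h l‖ ≤ M * (‖h‖ * ‖l‖) :=
  norm_tsum_le_of_le_mul hV.pos.le h l fun _ => norm_fderiv_sub_le hV _ _ _

theorem summable_remainderH (hV : TaylorBounds V M) (h l m : lp (fun _ : ι => F) 2) :
    Summable fun x => fderiv ℝ (fderiv ℝ V) (g x + h x) (l x) (m x) :=
  summable_of_le_mul l m (C := M) fun _ => by
    rw [← mul_assoc]
    exact ContinuousLinearMap.le_of_opNorm₂_le_of_le _ (hV.hess_le _) le_rfl le_rfl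

theorem norm_remainderD_sub_le (hV : TaylorBounds V M) (h z l : lp (fun _ : ι => F) 2) :
    ‖remainderD V g (h + z) l - remainderD V g h l‖ ≤ M * (‖z‖ * ‖l‖) := by
  rw [remainderD, remainderD,
    ← (summable_remainderD g hV (h + z) l).tsum_sub (summable_remainderD g hV h l)]
  refine norm_tsum_le_of_le_mul hV.pos.le z l fun x => ?_
  have := norm_fderiv_sub_le hV (g x + h x) (z x) (l x)
  simpa [add_assoc] using this

theorem norm_remainder_taylor_one (hV : TaylorBounds V M) (h z : lp (fun _ : ι => F) 2) :
    ‖remainder V g (h + z) - remainder V g h - remainderD V g h z‖ ≤ M * ‖z‖ ^ 2 := by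
  rw [remainder, remainder, remainderD,
    ← (summable_remainder g hV (h + z)).tsum_sub (summable_remainder g hV h),
    ← ((summable_remainder g hV (h + z)).sub (summable_remainder g hV h)).tsum_sub
      (summable_remainderD g hV h z), sq]
  refine norm_tsum_le_of_le_mul hV.pos.le z z fun x => ?_
  have := hV.taylor_one (g x + h x) (z x)
  rw [← sq]
  refine (le_of_eq ?_).trans this
  congr 1
  simp [add_assoc]
  ring

/-- A single value of `z` is bounded by its `ℓ²` norm. This takes one factor out of the pointwise
cubic error, and Cauchy–Schwarz sums the other two. -/
theorem norm_remainder_taylor_two (hV : TaylorBounds V M) (h z : lp (fun _ : ι => F) 2) :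
    ‖remainder V g (h + z) - remainder V g h - remainderD V g h z
      - 1 / 2 * remainderH V g h z z‖ ≤ M * ‖z‖ ^ 3 := by
  have s1 := (summable_remainder g hV (h + z)).sub (summable_remainder g hV h)
  have s2 := s1.sub (summable_remainderD g hV h z)
  rw [remainder, remainder, remainderD, remainderH, ← tsum_mul_left,
    ← (summable_remainder g hV (h + z)).tsum_sub (summable_remainder g hV h),
    ← s1.tsum_sub (summable_remainderD g hV h z),
    ← s2.tsum_sub ((summable_remainderH g hV h z z).mul_left _)]
  refine (norm_tsum_le_of_le_mul (C := M * ‖z‖) (mul_nonneg hV.pos.le (norm_nonneg _)) z z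
    fun x => ?_).trans (le_of_eq (by ring))
  have := hV.taylor_two (g x + h x) (z x)
  have h3 : M * ‖z x‖ ^ 3 ≤ M * ‖z‖ * (‖z x‖ * ‖z x‖) := by
    have h1 := lp.norm_apply_le_norm (two_ne_zero) z x
    have h2 := hV.pos.le
    calc M * ‖z x‖ ^ 3 = M * ‖z x‖ * (‖z x‖ * ‖z x‖) := by ring
      _ ≤ _ := by gcongr
  refine (le_of_eq ?_).trans (this.trans h3)
  congr 1
  simp [add_assoc]
  ring

theorem norm_remainderD_taylor_one (hV : TaylorBounds V M) (h z l : lp (fun _ : ι => F) 2) :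
    ‖remainderD V g (h + z) l - remainderD V g h l - remainderH V g h z l‖
      ≤ M * ‖z‖ ^ 2 * ‖l‖ := by
  have s1 := (summable_remainderD g hV (h + z) l).sub (summable_remainderD g hV h l)
  rw [remainderD, remainderD, remainderH,
    ← (summable_remainderD g hV (h + z) l).tsum_sub (summable_remainderD g hV h l),
    ← s1.tsum_sub (summable_remainderH g hV h z l)]
  refine (norm_tsum_le_of_le_mul (C := M * ‖z‖) (mul_nonneg hV.pos.le (norm_nonneg _)) z l
    fun x => ?_).trans (le_of_eq (by ring))
  have := ContinuousLinearMap.le_of_opNorm_le _ (hV.fderiv_taylor_one (g x + h x) (z x)) (l x)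
  have h3 : M * ‖z x‖ ^ 2 * ‖l x‖ ≤ M * ‖z‖ * (‖z x‖ * ‖l x‖) := by
    have h1 := lp.norm_apply_le_norm (two_ne_zero) z x
    have h2 := hV.pos.le
    calc M * ‖z x‖ ^ 2 * ‖l x‖ = M * ‖z x‖ * (‖z x‖ * ‖l x‖) := by ring
      _ ≤ _ := by gcongr
  refine (le_of_eq ?_).trans (this.trans h3)
  congr 1
  simp [add_assoc]

theorem norm_remainderH_sub_le (hV : TaylorBounds V M) (h z l m : lp (fun _ : ι => F) 2) :
    ‖remainderH V g (h + z) l m - remainderH V g h l m‖ ≤ M * ‖z‖ * (‖l‖ * ‖m‖) := by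
  rw [remainderH, remainderH,
    ← (summable_remainderH g hV (h + z) l m).tsum_sub (summable_remainderH g hV h l m)]
  refine norm_tsum_le_of_le_mul (mul_nonneg hV.pos.le (norm_nonneg _)) l m fun x => ?_
  have h1 : ‖fderiv ℝ (fderiv ℝ V) (g x + h x + z x) - fderiv ℝ (fderiv ℝ V) (g x + h x)‖
      ≤ M * ‖z‖ := (hV.hess_lip _ _).trans
    (mul_le_mul_of_nonneg_left (lp.norm_apply_le_norm two_ne_zero z x) hV.pos.le)
  have := ContinuousLinearMap.le_of_opNorm₂_le_of_le _ h1 (le_refl ‖l x‖) (le_refl ‖m x‖)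
  rw [← mul_assoc]
  simpa [add_assoc] using this

end Nonlinear

/-! ### Lines -/

/-- Lets the summed Taylor estimates yield derivatives along lines, so that no series has to be
differentiated term by term. -/
theorem hasDerivAt_of_norm_le_sq {f : ℝ → ℝ} {f' C t : ℝ}
    (h : ∀ ε, ‖f (t + ε) - f t - ε * f'‖ ≤ C * ε ^ 2) : HasDerivAt f f' t := by
  rw [hasDerivAt_iff_isLittleO_nhds_zero]
  have h1 : (fun ε => f (t + ε) - f t - ε • f') =O[𝓝 0] fun ε : ℝ => ε ^ 2 :=
    Asymptotics.IsBigO.of_bound C (Eventually.of_forall fun ε => by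
      simpa using h ε)
  refine h1.trans_isLittleO ?_
  simpa using Asymptotics.isLittleO_pow_id (𝕜 := ℝ) (n := 2) (by norm_num)

/-! ### The extended energy -/

section Extended

variable {R : Finset (Site k)} (V : EuclideanSpace ℝ R → ℝ) (g : Site k → EuclideanSpace ℝ R)
  (L : HDot R →L[ℝ] ℝ)

theorem norm_gradL (u : HDot R) : ‖gradL R u‖ = ‖u‖ := rfl

/-- The energy on the energy space; `L` is the first variation at the predictor and `g` is the
predictor strain. -/
def extEnergy (u : HDot R) : ℝ := L u + remainder V g (gradL R u)

/-- The first variation of `extEnergy`. -/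
def extEnergyD (u v : HDot R) : ℝ := L v + remainderD V g (gradL R u) (gradL R v)

/-- The second variation of `extEnergy`. -/
def extEnergyH (u v w : HDot R) : ℝ := remainderH V g (gradL R u) (gradL R v) (gradL R w)

theorem extEnergyD_smul (u v : HDot R) (t : ℝ) :
    extEnergyD V g L u (t • v) = t * extEnergyD V g L u v := by
  have : remainderD V g (gradL R u) (t • gradL R v)
      = t * remainderD V g (gradL R u) (gradL R v) := by
    rw [remainderD, remainderD, ← tsum_mul_left]
    congr 1
    funext x
    simp
    ring
  rw [extEnergyD, extEnergyD, map_smul, map_smul, this]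
  simp
  ring

theorem extEnergyH_smul (u v w : HDot R) (t : ℝ) :
    extEnergyH V g u (t • v) w = t * extEnergyH V g u v w := by
  rw [extEnergyH, extEnergyH, map_smul, remainderH, remainderH, ← tsum_mul_left]
  congr 1
  funext x
  simp

variable {V} {M : ℝ}

theorem norm_extEnergyD_le (hV : TaylorBounds V M) (u v : HDot R) :
    ‖extEnergyD V g L u v‖ ≤ (‖L‖ + M * ‖u‖) * ‖v‖ := by
  have h1 := norm_remainderD_le g hV (gradL R u) (gradL R v)
  rw [norm_gradL, norm_gradL] at h1
  calc _ ≤ ‖L v‖ + ‖remainderD V g (gradL R u) (gradL R v)‖ := norm_add_le _ _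
    _ ≤ ‖L‖ * ‖v‖ + M * (‖u‖ * ‖v‖) := add_le_add (L.le_opNorm v) h1
    _ = _ := by ring

theorem norm_extEnergyD_sub_le (hV : TaylorBounds V M) (u z v : HDot R) :
    ‖extEnergyD V g L (u + z) v - extEnergyD V g L u v‖ ≤ M * (‖z‖ * ‖v‖) := by
  rw [extEnergyD, extEnergyD, map_add, add_sub_add_left_eq_sub]
  exact norm_remainderD_sub_le g hV (gradL R u) (gradL R z) (gradL R v)

theorem norm_extEnergy_taylor_one (hV : TaylorBounds V M) (u z : HDot R) :
    ‖extEnergy V g L (u + z) - extEnergy V g L u - extEnergyD V g L u z‖ ≤ M * ‖z‖ ^ 2 := by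
  refine (le_of_eq ?_).trans (norm_remainder_taylor_one g hV (gradL R u) (gradL R z))
  rw [extEnergyD, extEnergy, extEnergy, map_add, map_add]
  congr 1; ring

theorem norm_extEnergy_taylor_two (hV : TaylorBounds V M) (u z : HDot R) :
    ‖extEnergy V g L (u + z) - extEnergy V g L u - extEnergyD V g L u z
      - 1 / 2 * extEnergyH V g u z z‖ ≤ M * ‖z‖ ^ 3 := by
  refine (le_of_eq ?_).trans (norm_remainder_taylor_two g hV (gradL R u) (gradL R z))
  rw [extEnergyD, extEnergy, extEnergy, map_add, map_add, extEnergyH]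
  congr 1; ring

theorem norm_extEnergyD_taylor_one (hV : TaylorBounds V M) (u z v : HDot R) :
    ‖extEnergyD V g L (u + z) v - extEnergyD V g L u v - extEnergyH V g u z v‖
      ≤ M * ‖z‖ ^ 2 * ‖v‖ := by
  rw [extEnergyD, extEnergyD, map_add, add_sub_add_left_eq_sub]
  exact norm_remainderD_taylor_one g hV (gradL R u) (gradL R z) (gradL R v)

theorem norm_extEnergyH_sub_le (hV : TaylorBounds V M) (u z v w : HDot R) :
    ‖extEnergyH V g (u + z) v w - extEnergyH V g u v w‖ ≤ M * ‖z‖ * (‖v‖ * ‖w‖) := by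
  rw [extEnergyH, extEnergyH, map_add]
  exact norm_remainderH_sub_le g hV (gradL R u) (gradL R z) (gradL R v) (gradL R w)

theorem continuous_extEnergy (hV : TaylorBounds V M) : Continuous (extEnergy V g L) := by
  rw [continuous_iff_continuousAt]
  intro u
  rw [ContinuousAt, tendsto_iff_norm_sub_tendsto_zero]
  have h1 : Tendsto (fun v : HDot R => (‖L‖ + M * ‖u‖) * ‖v - u‖ + M * ‖v - u‖ ^ 2) (𝓝 u)
      (𝓝 0) := by
    have : Continuous fun v : HDot R => (‖L‖ + M * ‖u‖) * ‖v - u‖ + M * ‖v - u‖ ^ 2 := by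
      fun_prop
    simpa using this.tendsto u
  refine squeeze_zero (fun _ => norm_nonneg _) (fun v => ?_) h1
  have h2 := norm_extEnergy_taylor_one g L hV u (v - u)
  have h3 := norm_extEnergyD_le g L hV u (v - u)
  rw [add_sub_cancel] at h2
  calc _ = ‖(extEnergy V g L v - extEnergy V g L u - extEnergyD V g L u (v - u))
        + extEnergyD V g L u (v - u)‖ := by congr 1; ring
    _ ≤ _ := (norm_add_le _ _).trans (by linarith)

theorem hasDerivAt_extEnergy_line (hV : TaylorBounds V M) (u v : HDot R) (t : ℝ) :
    HasDerivAt (fun t : ℝ => extEnergy V g L (u + t • v)) (extEnergyD V g L (u + t • v) v) t := by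
  refine hasDerivAt_of_norm_le_sq (C := M * ‖v‖ ^ 2) fun ε => ?_
  have := norm_extEnergy_taylor_one g L hV (u + t • v) (ε • v)
  rw [extEnergyD_smul, norm_smul, mul_pow, Real.norm_eq_abs ε, sq_abs] at this
  rw [add_smul, ← add_assoc]
  exact this.trans (le_of_eq (by ring))

theorem hasDerivAt_extEnergyD_line (hV : TaylorBounds V M) (u v : HDot R) (t : ℝ) :
    HasDerivAt (fun t : ℝ => extEnergyD V g L (u + t • v) v) (extEnergyH V g (u + t • v) v v)
      t := by
  refine hasDerivAt_of_norm_le_sq (C := M * ‖v‖ ^ 3) fun ε => ?_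
  have := norm_extEnergyD_taylor_one g L hV (u + t • v) (ε • v) v
  rw [extEnergyH_smul, norm_smul, mul_pow, Real.norm_eq_abs ε, sq_abs] at this
  rw [add_smul, ← add_assoc]
  exact this.trans (le_of_eq (by ring))

theorem iteratedDeriv_two_extEnergy_line (hV : TaylorBounds V M) (u v : HDot R) :
    iteratedDeriv 2 (fun t : ℝ => extEnergy V g L (u + t • v)) 0 = extEnergyH V g u v v := by
  rw [iteratedDeriv_succ, iteratedDeriv_one]
  have h1 : deriv (fun t : ℝ => extEnergy V g L (u + t • v))
      = fun t => extEnergyD V g L (u + t • v) v :=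
    funext fun t => (hasDerivAt_extEnergy_line g L hV u v t).deriv
  rw [h1, (hasDerivAt_extEnergyD_line g L hV u v 0).deriv]
  simp

end Extended

/-! ### Compactly supported displacements -/

section Compact

variable {R : Finset (Site k)}

theorem grad_support_finite {v : Site k → ℝ} (hv : v.support.Finite) :
    {x | grad R v x ≠ 0}.Finite := by
  have : {x | grad R v x ≠ 0} ⊆ v.support ∪ ⋃ ρ ∈ R, (fun x => x + ρ) ⁻¹' v.support := by
    intro x hx
    by_contra hx'
    simp only [mem_union, Function.mem_support, mem_iUnion, mem_preimage, not_or, not_exists,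
      not_not] at hx'
    apply hx
    ext ρ
    simp [grad, hx'.1, hx'.2 ρ.1 ρ.2]
  refine Finite.subset ?_ this
  refine hv.union (R.finite_toSet.biUnion fun ρ _ => ?_)
  exact hv.preimage (add_left_injective ρ).injOn

theorem mem_h1Submodule_of_support_finite {v : Site k → ℝ} (hv : v.support.Finite) :
    v ∈ h1Submodule R := by
  have : Memℓp (grad R v) 0 := memℓp_zero (grad_support_finite hv)
  exact this.of_exponent_ge (by norm_num)

/-- A finitely supported function as an element of the energy space. -/
def ofFinite (R : Finset (Site k)) (v : Site k → ℝ) (hv : v.support.Finite) : HDot R :=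
  ⟨v, mem_h1Submodule_of_support_finite hv⟩

/-- The compactly supported displacements that vanish outside `Ω`, as a subspace. -/
def H0Submodule (R : Finset (Site k)) (Ω : Set (Site k)) : Submodule ℝ (HDot R) where
  carrier := H0 R Ω
  zero_mem' := by
    refine ⟨?_, fun x _ => rfl⟩
    change (Function.support (0 : Site k → ℝ)).Finite
    simp
  add_mem' := by
    intro u v hu hv
    refine ⟨(hu.1.union hv.1).subset (Function.support_add u.1 v.1), fun x hx => ?_⟩
    change u.1 x + v.1 x = 0
    rw [hu.2 x hx, hv.2 x hx, add_zero]
  smul_mem' := by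
    intro c u hu
    refine ⟨hu.1.subset (Function.support_const_smul_subset c u.1), fun x hx => ?_⟩
    change c * u.1 x = 0
    rw [hu.2 x hx, mul_zero]

theorem H0_univ : (H0 R univ) = Hc R := by
  ext v; simp [H0]

theorem mem_Hc_iff {v : HDot R} : v ∈ Hc R ↔ v ∈ H0Submodule R univ := by
  rw [← H0_univ]; rfl

variable {V : EuclideanSpace ℝ R → ℝ} {M : ℝ} {uPred : Site k → ℝ}
  {L : HDot R →L[ℝ] ℝ}

/-- For compact support the linear part is a finite sum, so it may be split off the energy and added
back as `L v`. -/
theorem energyC_eq_extEnergy (hV : TaylorBounds V M)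
    (hL : ∀ v ∈ Hc R, L v = ∑' x, fderiv ℝ V (grad R uPred x) (grad R v.1 x)) {v : HDot R}
    (hv : v ∈ Hc R) : energyC R V uPred v = extEnergy V (grad R uPred) L v := by
  have h1 := summable_remainder (grad R uPred) hV (gradL R v)
  have h2 : Summable fun x => fderiv ℝ V (grad R uPred x) (grad R v.1 x) :=
    summable_of_hasFiniteSupport ((grad_support_finite (R := R) hv).subset fun x hx hx' => hx (by simp [hx']))
  rw [extEnergy, hL v hv, add_comm, remainder]
  exact (tsum_congr fun x => (sub_add_cancel _ _).symm).trans (h1.tsum_add h2)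

/-- `extEnergy` is continuous and agrees with the energy on `Hc R`, hence is its limit at every
point of the closure. -/
theorem energy_eq_extEnergy (hV : TaylorBounds V M)
    (hL : ∀ v ∈ Hc R, L v = ∑' x, fderiv ℝ V (grad R uPred x) (grad R v.1 x)) {u : HDot R}
    (hu : u ∈ closure (Hc R)) : energy R V uPred u = extEnergy V (grad R uPred) L u := by
  refine extendFrom_eq hu ?_
  refine (((continuous_extEnergy (grad R uPred) L hV).tendsto u).mono_left
    nhdsWithin_le_nhds).congr' ?_
  filter_upwards [self_mem_nhdsWithin] with v hv
  exact (energyC_eq_extEnergy hV hL hv).symm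

theorem add_smul_mem_closure_Hc {u v : HDot R} (hu : u ∈ closure (Hc R)) (hv : v ∈ Hc R) (t : ℝ) :
    u + t • v ∈ closure (Hc R) := by
  have h : Hc R = (H0Submodule R univ : Set (HDot R)) := by rw [← H0_univ]; rfl
  rw [h] at hu hv ⊢
  exact (H0Submodule R univ).topologicalClosure.add_mem hu
    ((H0Submodule R univ).topologicalClosure.smul_mem t (subset_closure hv))

theorem secondVariation_energy (hV : TaylorBounds V M)
    (hL : ∀ v ∈ Hc R, L v = ∑' x, fderiv ℝ V (grad R uPred x) (grad R v.1 x)) {u v : HDot R}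
    (hu : u ∈ closure (Hc R)) (hv : v ∈ Hc R) :
    secondVariation (energy R V uPred) u v = extEnergyH V (grad R uPred) u v v := by
  rw [← iteratedDeriv_two_extEnergy_line (grad R uPred) L hV, secondVariation]
  congr 1
  funext t
  exact energy_eq_extEnergy hV hL (add_smul_mem_closure_Hc hu hv t)

theorem extEnergyD_eq_zero_of_isLocalMin (hV : TaylorBounds V M)
    (hL : ∀ v ∈ Hc R, L v = ∑' x, fderiv ℝ V (grad R uPred x) (grad R v.1 x)) {u v : HDot R}
    (hu : u ∈ closure (Hc R)) (hv : v ∈ Hc R) (hmin : IsLocalMin (energy R V uPred) u) :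
    extEnergyD V (grad R uPred) L u v = 0 := by
  have hc : Continuous fun t : ℝ => u + t • v := by fun_prop
  have h0 : u + (0 : ℝ) • v = u := by simp
  have h1 : IsLocalMin (fun t : ℝ => extEnergy V (grad R uPred) L (u + t • v)) 0 := by
    have h2 := (hc.tendsto 0)
    rw [h0] at h2
    filter_upwards [h2.eventually hmin] with t ht
    rw [h0, ← energy_eq_extEnergy hV hL hu,
      ← energy_eq_extEnergy hV hL (add_smul_mem_closure_Hc hu hv t)]
    exact ht
  have h3 := h1.hasDerivAt_eq_zero (hasDerivAt_extEnergy_line (grad R uPred) L hV u v 0)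
  rwa [h0] at h3

end Compact

/-! ### Lattice coordinates -/

theorem LatticeKind.tau_im_pos (k : LatticeKind) : 0 < k.tau.im := by
  cases k <;> simp [LatticeKind.tau]

/-- The lattice is freely generated by `1` and `tau`. -/
def siteEquiv (k : LatticeKind) : ℤ × ℤ ≃+ Site k :=
  AddEquiv.ofBijective
    (AddMonoidHom.mk' (fun p : ℤ × ℤ => (⟨(p.1 : ℂ) + p.2 * k.tau, p.1, p.2, rfl⟩ : Site k))
      (by
        intro p q
        apply Subtype.ext
        simp
        ring))
    (by
      constructor
      · intro p q h
        have h1 : (p.1 : ℂ) + p.2 * k.tau = (q.1 : ℂ) + q.2 * k.tau := congrArg Subtype.val h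
        have him := congrArg Complex.im h1
        have hre := congrArg Complex.re h1
        simp at him hre
        have h2 : p.2 = q.2 := by
          rcases him with h | h
          · exact h
          · exact absurd h k.tau_im_pos.ne'
        rw [h2] at hre
        simp at hre
        exact Prod.ext hre h2
      · rintro ⟨_, m, n, rfl⟩
        exact ⟨(m, n), rfl⟩)

theorem siteEquiv_coe (p : ℤ × ℤ) : ((siteEquiv k p : Site k) : ℂ) = (p.1 : ℂ) + p.2 * k.tau :=
  rfl

/-- The maximum norm of the lattice coordinates of a site. -/
def supNorm (x : Site k) : ℕ :=
  max ((siteEquiv k).symm x).1.natAbs ((siteEquiv k).symm x).2.natAbs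

theorem supNorm_siteEquiv (p : ℤ × ℤ) : supNorm (siteEquiv k p) = max p.1.natAbs p.2.natAbs := by
  simp [supNorm]

theorem supNorm_add_le (x y : Site k) : supNorm (x + y) ≤ supNorm x + supNorm y := by
  simp only [supNorm, map_add, Prod.fst_add, Prod.snd_add]
  omega

theorem supNorm_neg (x : Site k) : supNorm (-x) = supNorm x := by
  simp [supNorm]

theorem norm_le_supNorm (x : Site k) : ‖(x : ℂ)‖ ≤ 2 * supNorm x := by
  obtain ⟨p, rfl⟩ := (siteEquiv k).surjective x
  rw [supNorm_siteEquiv, siteEquiv_coe]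
  have ht : ‖k.tau‖ = 1 := by
    cases k <;> simp [LatticeKind.tau, Complex.norm_def, Complex.normSq_apply] <;> (ring_nf; norm_num)
  have h1 : ‖(p.1 : ℂ) + p.2 * k.tau‖ ≤ |(p.1 : ℝ)| + |(p.2 : ℝ)| := by
    refine (norm_add_le _ _).trans ?_
    simp [ht]
  have h2 : |(p.1 : ℝ)| ≤ max p.1.natAbs p.2.natAbs := by
    rw [← Int.cast_abs, Int.abs_eq_natAbs]; simp
  have h3 : |(p.2 : ℝ)| ≤ max p.1.natAbs p.2.natAbs := by
    rw [← Int.cast_abs, Int.abs_eq_natAbs]; simp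
  linarith

/-- Together with `norm_le_supNorm` this lets square shells, which are easy to count, replace
Euclidean ones. -/
theorem supNorm_le_norm (x : Site k) : supNorm x ≤ 2 * ‖(x : ℂ)‖ := by
  obtain ⟨p, rfl⟩ := (siteEquiv k).surjective x
  rw [supNorm_siteEquiv, siteEquiv_coe]
  have key : ((p.1 : ℝ) ^ 2 ≤ (2 * ‖(p.1 : ℂ) + p.2 * k.tau‖) ^ 2)
      ∧ ((p.2 : ℝ) ^ 2 ≤ (2 * ‖(p.1 : ℂ) + p.2 * k.tau‖) ^ 2) := by
    rw [mul_pow, Complex.sq_norm, Complex.normSq_apply]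
    have h3 : Real.sqrt 3 * Real.sqrt 3 = 3 := Real.mul_self_sqrt (by norm_num)
    cases k
    · simp [LatticeKind.tau]
      constructor <;> nlinarith [sq_nonneg (p.1 : ℝ), sq_nonneg (p.2 : ℝ)]
    · simp [LatticeKind.tau]
      have : (p.2 : ℝ) * (Real.sqrt 3 / 2) * (p.2 * (Real.sqrt 3 / 2)) = 3 / 4 * (p.2 : ℝ) ^ 2 := by
        linear_combination ((p.2 : ℝ) ^ 2 / 4) * h3
      rw [this]
      constructor <;> nlinarith [sq_nonneg (2 * (p.1 : ℝ) + p.2), sq_nonneg ((p.1 : ℝ) + 2 * p.2),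
        sq_nonneg (p.1 : ℝ), sq_nonneg (p.2 : ℝ)]
  push_cast
  rw [Nat.cast_natAbs, Nat.cast_natAbs, Int.cast_abs, Int.cast_abs]
  exact max_le (abs_le_of_sq_le_sq key.1 (by positivity))
    (abs_le_of_sq_le_sq key.2 (by positivity))

theorem mem_box_iff_supNorm {p : ℤ × ℤ} {n : ℕ} :
    p ∈ (Finset.box n : Finset (ℤ × ℤ)) ↔ supNorm (siteEquiv k p) = n := by
  rw [Int.mem_box, supNorm_siteEquiv]

theorem finite_supNorm_le (k : LatticeKind) (n : ℕ) : {x : Site k | supNorm x ≤ n}.Finite := by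
  have : {x : Site k | supNorm x ≤ n} ⊆
      ⋃ j ∈ Finset.range (n + 1), siteEquiv k '' (Finset.box j : Finset (ℤ × ℤ)) := by
    intro x hx
    obtain ⟨p, rfl⟩ := (siteEquiv k).surjective x
    simp only [mem_iUnion]
    exact ⟨_, Finset.mem_range.2 (Nat.lt_succ_of_le hx), p, mem_box_iff_supNorm.2 rfl, rfl⟩
  exact ((Finset.finite_toSet _).biUnion fun j _ => (Finset.finite_toSet _).image _).subset this

theorem tendsto_norm_cofinite (k : LatticeKind) :
    Tendsto (fun x : Site k => ‖(x : ℂ)‖) cofinite atTop := by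
  rw [tendsto_atTop]
  intro b
  have hfin : {x : Site k | ‖(x : ℂ)‖ < b}.Finite := by
    refine (finite_supNorm_le k ⌈2 * b⌉₊).subset fun x hx => ?_
    have h1 := supNorm_le_norm x
    have h2 : (supNorm x : ℝ) ≤ ⌈2 * b⌉₊ := by
      refine h1.trans (le_trans ?_ (Nat.le_ceil _))
      have : ‖(x : ℂ)‖ < b := hx
      linarith
    exact_mod_cast h2
  filter_upwards [hfin.compl_mem_cofinite] with x hx
  exact not_lt.1 hx

/-! ### Tails of lattice sums -/

/-- With `t = 1 / j ≤ 1`, the bound `log (1 + t) ≥ t / 2` gives `(1 + t) ^ β ≥ 1 + β t / 2`, whose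
inverse is at most `1 - β t / (2 + β)`. This is an integral comparison in telescoping form. -/
theorem rpow_neg_telescope {β : ℝ} (hβ : 0 < β) {j : ℝ} (hj : 1 ≤ j) :
    β / (2 + β) * j ^ (-β - 1) ≤ j ^ (-β) - (j + 1) ^ (-β) := by
  have hj0 : 0 < j := by linarith
  have h1 : (j + 1) ^ (-β) ≤ j ^ (-β) * (1 - β / (2 + β) * (1 / j)) := by
    have e : j + 1 = j * (1 + 1 / j) := by field_simp
    rw [e, Real.mul_rpow hj0.le (by positivity)]
    gcongr
    have ht : 0 < 1 / j := by positivity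
    have ht1 : 1 / j ≤ 1 := by rw [div_le_one hj0]; exact hj
    set t := 1 / j
    rw [Real.rpow_neg (by positivity)]
    have h2 : 1 + β * (t / 2) ≤ (1 + t) ^ β := by
      rw [Real.rpow_def_of_pos (by positivity), mul_comm]
      have h3 : t / 2 ≤ Real.log (1 + t) := by
        have := Real.one_sub_inv_le_log_of_pos (show 0 < 1 + t by positivity)
        refine le_trans ?_ this
        have : 1 - (1 + t)⁻¹ = t / (1 + t) := by field_simp; ring
        rw [this]
        gcongr
        linarith
      have := Real.add_one_le_exp (β * Real.log (1 + t))
      rw [mul_comm β] at this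
      nlinarith
    have h4 : ((1 + t) ^ β)⁻¹ ≤ (1 + β * (t / 2))⁻¹ := by
      gcongr
    refine h4.trans ?_
    rw [inv_le_iff_one_le_mul₀ (by positivity)]
    have : (1 - β / (2 + β) * t) * (1 + β * (t / 2))
        = 1 + (β * t) * (β * (1 - t)) / (2 * (2 + β)) := by
      field_simp; ring
    rw [this]
    have : 0 ≤ 1 - t := by linarith
    have : 0 ≤ (β * t) * (β * (1 - t)) / (2 * (2 + β)) := by positivity
    linarith
  rw [Real.rpow_sub_one hj0.ne']
  have : j ^ (-β) * (1 - β / (2 + β) * (1 / j)) = j ^ (-β) - β / (2 + β) * (j ^ (-β) / j) := by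
    ring
  linarith

/-- The shell of sup norm `j` has `8 j` sites, so it contributes at most `8 j ^ (1 - α)`; these
bounds are dominated by a telescoping sum. -/
theorem sum_supNorm_rpow_le {α : ℝ} (hα : 2 < α) {T : ℝ} (hT : 1 ≤ T) (S : Finset (Site k))
    (hS : ∀ x ∈ S, T ≤ supNorm x) :
    ∑ x ∈ S, (supNorm x : ℝ) ^ (-α) ≤ 8 * (α / (α - 2)) * T ^ (2 - α) := by
  classical
  obtain ⟨b, hb⟩ := (S.image supNorm).exists_nat_subset_range
  set n₀ := ⌈T⌉₊ with hn₀
  have hn1 : 1 ≤ n₀ := Nat.one_le_ceil_iff.2 (by linarith)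
  have hmaps : ∀ x ∈ S, supNorm x ∈ Finset.Ico n₀ (n₀ + b) := by
    intro x hx
    have h1 := Finset.mem_range.1 (hb (Finset.mem_image_of_mem _ hx))
    have h2 := Nat.ceil_le.2 (hS x hx)
    rw [Finset.mem_Ico]
    omega
  set β := α - 2 with hβ
  have hβ0 : 0 < β := by linarith
  rw [← Finset.sum_fiberwise_of_maps_to hmaps]
  have h1 : ∀ j ∈ Finset.Ico n₀ (n₀ + b),
      ∑ x ∈ S with supNorm x = j, (supNorm x : ℝ) ^ (-α)
        ≤ 8 * ((2 + β) / β) * ((j : ℝ) ^ (-β) - ((j + 1 : ℕ) : ℝ) ^ (-β)) := by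
    intro j hj
    have hj1 : 1 ≤ j := hn1.trans (Finset.mem_Ico.1 hj).1
    have hj0 : (0 : ℝ) < j := by exact_mod_cast hj1
    have hcard : ((S.filter fun x => supNorm x = j).card : ℝ) ≤ 8 * j := by
      have : (S.filter fun x => supNorm x = j).card ≤ (Finset.box j : Finset (ℤ × ℤ)).card := by
        refine Finset.card_le_card_of_injOn (siteEquiv k).symm ?_
          (siteEquiv k).symm.injective.injOn
        intro x hx
        have := (Finset.mem_filter.1 hx).2
        exact (mem_box_iff_supNorm (k := k)).2 (by simpa using this)
      rw [Int.card_box (by omega)] at this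
      exact_mod_cast this
    calc ∑ x ∈ S with supNorm x = j, (supNorm x : ℝ) ^ (-α)
        = ∑ x ∈ S with supNorm x = j, (j : ℝ) ^ (-α) :=
          Finset.sum_congr rfl fun x hx => by rw [(Finset.mem_filter.1 hx).2]
      _ = (S.filter fun x => supNorm x = j).card * (j : ℝ) ^ (-α) := by simp
      _ ≤ 8 * j * (j : ℝ) ^ (-α) := by gcongr
      _ = 8 * ((j : ℝ) ^ (-β - 1)) := by
          have : -α = -β - 1 - 1 := by rw [hβ]; ring
          rw [this, Real.rpow_sub_one hj0.ne']
          field_simp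
      _ = 8 * ((2 + β) / β) * (β / (2 + β) * (j : ℝ) ^ (-β - 1)) := by field_simp
      _ ≤ _ := by
          have := rpow_neg_telescope hβ0 (j := j) (by exact_mod_cast hj1)
          push_cast
          gcongr
  refine (Finset.sum_le_sum h1).trans ?_
  rw [← Finset.mul_sum, Finset.sum_Ico_eq_sum_range]
  have h2 := Finset.sum_range_sub' (fun i : ℕ => (((n₀ + i : ℕ) : ℝ)) ^ (-β)) b
  have h3 : ∑ i ∈ Finset.range b,
      (((n₀ + i : ℕ) : ℝ) ^ (-β) - ((n₀ + i + 1 : ℕ) : ℝ) ^ (-β)) ≤ T ^ (-β) := by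
    have h4 : (n₀ : ℝ) ^ (-β) ≤ T ^ (-β) :=
      Real.rpow_le_rpow_of_nonpos (by linarith) (Nat.le_ceil _) (by linarith)
    have h5 : (0 : ℝ) ≤ ((n₀ + b : ℕ) : ℝ) ^ (-β) := by positivity
    rw [add_zero] at h2
    exact (le_of_eq h2).trans (by linarith)
  have e1 : (2 + β) / β = α / β := by rw [hβ]; ring_nf
  have e2 : 2 - α = -β := by rw [hβ]; ring
  rw [e1, e2, Nat.add_sub_cancel_left]
  gcongr

theorem summable_norm_rpow {α : ℝ} (hα : 2 < α) :
    Summable fun x : Site k => ‖(x : ℂ)‖ ^ (-α) := by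
  have h1 : Summable fun x : Site k => if 1 ≤ supNorm x then (supNorm x : ℝ) ^ (-α) else 0 := by
    refine summable_of_sum_le (c := 8 * (α / (α - 2)) * 1 ^ (2 - α)) (fun x => ?_) fun S => ?_
    · change (0 : ℝ) ≤ ite _ _ _
      split_ifs <;> positivity
    · classical
      rw [← Finset.sum_filter]
      exact sum_supNorm_rpow_le hα le_rfl _ fun x hx => by
        exact_mod_cast (Finset.mem_filter.1 hx).2
  refine summable_of_isBigO h1 ?_
  refine Asymptotics.IsBigO.of_bound (2 ^ α) ?_
  filter_upwards [(tendsto_norm_cofinite k).eventually_gt_atTop 0] with x hx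
  have h2 := norm_le_supNorm x
  have h3 : 1 ≤ supNorm x := by
    by_contra h
    have : supNorm x = 0 := by omega
    rw [this] at h2
    simp at h2
    simp [h2] at hx
  have h0 : (0 : ℝ) < supNorm x := by exact_mod_cast h3
  rw [if_pos h3, Real.norm_of_nonneg (by positivity), Real.norm_of_nonneg (by positivity)]
  have h4 : (supNorm x : ℝ) / 2 ≤ ‖(x : ℂ)‖ := by linarith [supNorm_le_norm x]
  calc ‖(x : ℂ)‖ ^ (-α) ≤ ((supNorm x : ℝ) / 2) ^ (-α) :=
        Real.rpow_le_rpow_of_nonpos (by positivity) h4 (by linarith)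
    _ = 2 ^ α * (supNorm x : ℝ) ^ (-α) := by
        rw [Real.div_rpow h0.le (by norm_num), Real.rpow_neg (by norm_num : (0 : ℝ) ≤ 2)]
        field_simp

/-! ### Differences in arbitrary lattice directions -/

section Directions

variable {R : Finset (Site k)}

theorem abs_sub_le_norm_grad {e : Site k} (he : e ∈ R) (u : Site k → ℝ) (x : Site k) :
    |u (x + e) - u x| ≤ ‖grad R u x‖ := by
  have := EuclideanSpace.norm_sq_eq (grad R u x)
  have h1 : ‖grad R u x ⟨e, he⟩‖ ^ 2 ≤ ‖grad R u x‖ ^ 2 := by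
    rw [this]
    exact Finset.single_le_sum (f := fun i => ‖grad R u x i‖ ^ 2) (fun _ _ => by positivity)
      (Finset.mem_univ _)
  exact le_of_sq_le_sq h1 (by positivity)

/-- Since `R` generates the lattice, the step `e` is a finite path of bonds in `±R`, which stays
within a fixed distance of `x`. -/
theorem exists_abs_sub_le (hR : AddSubgroup.closure (R : Set (Site k)) = ⊤) (e : Site k) :
    ∃ (C : ℝ) (K : ℕ), 0 ≤ C ∧ ∀ (u : Site k → ℝ) (x : Site k) (B : ℝ),
      (∀ y, supNorm y ≤ K → ‖grad R u (x + y)‖ ≤ B) → |u (x + e) - u x| ≤ C * B := by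
  have he : e ∈ AddSubgroup.closure (R : Set (Site k)) := by rw [hR]; trivial
  induction he using AddSubgroup.closure_induction with
  | mem e he =>
    refine ⟨1, 0, zero_le_one, fun u x B h => ?_⟩
    have := h 0 (by simp [supNorm])
    rw [add_zero] at this
    rw [one_mul]
    exact (abs_sub_le_norm_grad he u x).trans this
  | zero => exact ⟨0, 0, le_rfl, fun u x B h => by simp⟩
  | add e f _ _ ihe ihf =>
    obtain ⟨C, K, hC, h⟩ := ihe
    obtain ⟨C', K', hC', h'⟩ := ihf
    refine ⟨C + C', K + (K' + supNorm e), by positivity, fun u x B hB => ?_⟩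
    have h1 := h u x B fun y hy => hB y (by omega)
    have h2 := h' u (x + e) B fun y hy => by
      rw [add_assoc]
      refine hB _ ((supNorm_add_le _ _).trans (by omega))
    calc |u (x + (e + f)) - u x| = |(u (x + e + f) - u (x + e)) + (u (x + e) - u x)| := by
          rw [add_assoc]; congr 1; ring
      _ ≤ _ := (abs_add_le _ _).trans (by linarith)
  | neg e _ ih =>
    obtain ⟨C, K, hC, h⟩ := ih
    refine ⟨C, K + supNorm e, hC, fun u x B hB => ?_⟩
    have h1 := h u (x + -e) B fun y hy => by
      rw [add_assoc]
      refine hB _ ((supNorm_add_le _ _).trans ?_)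
      rw [supNorm_neg]; omega
    rw [neg_add_cancel_right, abs_sub_comm] at h1
    exact h1

/-- The `ℓ²` version of the path argument: translation invariance of the sum gives every bond of the
path the same bound. -/
theorem exists_summable_sub_sq (hR : AddSubgroup.closure (R : Set (Site k)) = ⊤) (e : Site k) :
    ∃ C : ℝ, 0 ≤ C ∧ ∀ v : HDot R, Summable (fun x => (v.1 (x + e) - v.1 x) ^ 2) ∧
      ∑' x, (v.1 (x + e) - v.1 x) ^ 2 ≤ C * ‖v‖ ^ 2 := by
  have he : e ∈ AddSubgroup.closure (R : Set (Site k)) := by rw [hR]; trivial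
  induction he using AddSubgroup.closure_induction with
  | mem e he =>
    refine ⟨1, zero_le_one, fun v => ?_⟩
    have h0 := lp_summable_sq (gradL R v)
    have h1 : ∀ x, (v.1 (x + e) - v.1 x) ^ 2 ≤ ‖gradL R v x‖ ^ 2 := fun x => by
      rw [← sq_abs]
      exact pow_le_pow_left₀ (abs_nonneg _) (abs_sub_le_norm_grad he v.1 x) 2
    have h2 := Summable.of_nonneg_of_le (fun x => by positivity) h1 h0
    refine ⟨h2, ?_⟩
    rw [one_mul, ← norm_gradL, ← lp_tsum_sq]
    exact h2.tsum_le_tsum h1 h0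
  | zero => exact ⟨0, le_rfl, fun v => by simp⟩
  | add e f _ _ ihe ihf =>
    obtain ⟨C, hC, h⟩ := ihe
    obtain ⟨C', hC', h'⟩ := ihf
    refine ⟨2 * C + 2 * C', by positivity, fun v => ?_⟩
    obtain ⟨s1, t1⟩ := h v
    obtain ⟨s2, t2⟩ := h' v
    have s3 : Summable fun x => (v.1 (x + e + f) - v.1 (x + e)) ^ 2 := by
      have := (Equiv.addRight e).summable_iff.2 s2
      simpa only [Function.comp_def, Equiv.coe_addRight] using this
    have t3 := (Equiv.addRight e).tsum_eq fun x => (v.1 (x + f) - v.1 x) ^ 2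
    simp only [Equiv.coe_addRight] at t3
    rw [← t3] at t2
    have s4 := (s1.mul_left 2).add (s3.mul_left 2)
    have h1 : ∀ x, (v.1 (x + (e + f)) - v.1 x) ^ 2 ≤
        2 * (v.1 (x + e) - v.1 x) ^ 2 + 2 * (v.1 (x + e + f) - v.1 (x + e)) ^ 2 := fun x => by
      rw [← add_assoc]
      nlinarith [sq_nonneg ((v.1 (x + e) - v.1 x) - (v.1 (x + e + f) - v.1 (x + e)))]
    have h2 := Summable.of_nonneg_of_le (fun x => by positivity) h1 s4
    refine ⟨h2, (h2.tsum_le_tsum h1 s4).trans ?_⟩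
    rw [(s1.mul_left 2).tsum_add (s3.mul_left 2), tsum_mul_left, tsum_mul_left]
    linarith
  | neg e _ ih =>
    obtain ⟨C, hC, h⟩ := ih
    refine ⟨C, hC, fun v => ?_⟩
    obtain ⟨s1, t1⟩ := h v
    have s3 := (Equiv.addRight (-e)).summable_iff.2 s1
    have t3 := (Equiv.addRight (-e)).tsum_eq fun x => (v.1 (x + e) - v.1 x) ^ 2
    have key : (fun x => (v.1 (x + -e) - v.1 x) ^ 2)
        = (fun x => (v.1 (x + e) - v.1 x) ^ 2) ∘ Equiv.addRight (-e) := by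
      funext x
      simp
      ring
    rw [key]
    exact ⟨s3, (le_of_eq t3).trans t1⟩

end Directions

/-! ### Decay of strains -/

/-- Writes `n = (J / 4) * l` with `l = 4 n / J ≥ 1` and absorbs `log l` into a small power of `l`.
Logarithms at all scales beyond `J / 4` can thus be traded for `log J`. -/
theorem exists_log_pow_le {δ : ℝ} (hδ : 0 < δ) (r : ℕ) :
    ∃ C, 0 < C ∧ ∀ J n : ℝ, Real.exp 1 ≤ J → J / 4 ≤ n → 1 ≤ n →
      Real.log n ^ r ≤ C * Real.log J ^ r * (n / J) ^ δ := by
  -- The `+ 1` keeps `ε` positive for `r = 0` as well, while `ε * r ≤ δ` still holds.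
  set ε := δ / (r + 1) with hε
  have hε0 : 0 < ε := by positivity
  refine ⟨(1 + 1 / ε) ^ r * 4 ^ δ, by positivity, fun J n hJ hn hn1 => ?_⟩
  have hJ0 : 0 < J := (Real.exp_pos 1).trans_le hJ
  have hn0 : 0 < n := by linarith
  have hl1 : 1 ≤ 4 * n / J := by rw [le_div_iff₀ hJ0]; linarith
  have hlJ : 1 ≤ Real.log J := by rwa [Real.le_log_iff_exp_le hJ0]
  set l := 4 * n / J with hl
  have hl0 : 0 < l := by linarith
  have hn' : n = J / 4 * l := by rw [hl]; field_simp
  have hlog : Real.log n ≤ Real.log J * ((1 + 1 / ε) * l ^ ε) := by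
    rw [hn', Real.log_mul (by positivity) hl0.ne']
    have h1 : Real.log (J / 4) ≤ Real.log J := Real.log_le_log (by positivity) (by linarith)
    have h2 : Real.log l ≤ l ^ ε / ε := Real.log_le_rpow_div hl0.le hε0
    have h3 : 1 ≤ l ^ ε := Real.one_le_rpow hl1 hε0.le
    have h4 : 0 ≤ Real.log l := Real.log_nonneg hl1
    calc _ ≤ Real.log J * 1 + Real.log J * Real.log l := by nlinarith
      _ ≤ Real.log J * l ^ ε + Real.log J * (l ^ ε / ε) := by gcongr
      _ = _ := by ring
  calc Real.log n ^ r ≤ (Real.log J * ((1 + 1 / ε) * l ^ ε)) ^ r :=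
        pow_le_pow_left₀ (Real.log_nonneg hn1) hlog r
    _ = (1 + 1 / ε) ^ r * Real.log J ^ r * (l ^ ε) ^ r := by rw [mul_pow, mul_pow]; ring
    _ ≤ (1 + 1 / ε) ^ r * Real.log J ^ r * l ^ δ := by
        gcongr
        rw [← Real.rpow_natCast, ← Real.rpow_mul hl0.le]
        refine Real.rpow_le_rpow_of_exponent_le hl1 ?_
        rw [hε, div_mul_eq_mul_div, div_le_iff₀ (by positivity)]
        nlinarith
    _ = _ := by
        rw [hl, mul_div_assoc, Real.mul_rpow (by norm_num) (by positivity)]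
        ring

section Decay

variable {R : Finset (Site k)} {u : Site k → ℝ} {s : ℝ} {r : ℕ}

/-- The expected size of the truncation error. -/
def truncRate (s : ℝ) (r : ℕ) (J : ℝ) : ℝ := J ^ (1 - s) * Real.log J ^ r

theorem truncRate_pos {J : ℝ} (hJ : 1 < J) : 0 < truncRate s r J := by
  have := Real.log_pos hJ
  unfold truncRate
  positivity

theorem exists_grad_le_supNorm (hs : 1 < s)
    (hdecay : ∃ C₀ r₀ : ℝ, ∀ x : Site k, r₀ ≤ ‖(x : ℂ)‖ →
      ‖grad R u x‖ ≤ C₀ * ‖(x : ℂ)‖ ^ (-s) * Real.log ‖(x : ℂ)‖ ^ r) :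
    ∃ C n₀ : ℝ, 0 < C ∧ 2 ≤ n₀ ∧ ∀ x : Site k, n₀ ≤ supNorm x →
      ‖grad R u x‖ ≤ C * (supNorm x : ℝ) ^ (-s) * Real.log (supNorm x) ^ r := by
  obtain ⟨C₀, r₀, h⟩ := hdecay
  refine ⟨(|C₀| + 1) * 2 ^ s * 2 ^ r, max 2 (2 * r₀), by positivity, le_max_left _ _,
    fun x hx => ?_⟩
  have hx2 : (2 : ℝ) ≤ supNorm x := (le_max_left _ _).trans hx
  have hxr : 2 * r₀ ≤ supNorm x := (le_max_right _ _).trans hx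
  have h1 := supNorm_le_norm x
  have h2 := norm_le_supNorm x
  have hx1 : 1 ≤ ‖(x : ℂ)‖ := by linarith
  set n : ℝ := (supNorm x : ℝ)
  refine (h x (by linarith)).trans ?_
  have e1 : ‖(x : ℂ)‖ ^ (-s) ≤ 2 ^ s * n ^ (-s) := by
    calc ‖(x : ℂ)‖ ^ (-s) ≤ (n / 2) ^ (-s) :=
          Real.rpow_le_rpow_of_nonpos (by positivity) (by linarith) (by linarith)
      _ = _ := by
          rw [Real.div_rpow (by linarith) (by norm_num), Real.rpow_neg (by norm_num : (0:ℝ) ≤ 2)]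
          field_simp
  have e2 : Real.log ‖(x : ℂ)‖ ≤ 2 * Real.log n := by
    have : Real.log ‖(x : ℂ)‖ ≤ Real.log (n ^ 2) :=
      Real.log_le_log (by linarith) (by nlinarith)
    rwa [Real.log_pow] at this
  have e3 : C₀ ≤ |C₀| + 1 := by linarith [le_abs_self C₀]
  have e4 := Real.log_nonneg hx1
  calc C₀ * ‖(x : ℂ)‖ ^ (-s) * Real.log ‖(x : ℂ)‖ ^ r
      ≤ (|C₀| + 1) * (2 ^ s * n ^ (-s)) * (2 * Real.log n) ^ r := by gcongr
    _ = _ := by ring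

/-- Half of the surplus decay `s - 1` pays for the logarithm. The exponent `(s + 1) / 2` that
remains exceeds `1`, so the bound is still square-summable in the plane. -/
theorem exists_grad_le_of_annulus (hs : 1 < s)
    (hdecay : ∃ C₀ r₀ : ℝ, ∀ x : Site k, r₀ ≤ ‖(x : ℂ)‖ →
      ‖grad R u x‖ ≤ C₀ * ‖(x : ℂ)‖ ^ (-s) * Real.log ‖(x : ℂ)‖ ^ r) :
    ∃ C J₀ : ℝ, 0 < C ∧ 4 ≤ J₀ ∧ ∀ J, J₀ ≤ J → ∀ x : Site k, J / 4 ≤ supNorm x →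
      ‖grad R u x‖ ≤ C * Real.log J ^ r * J ^ (-((s - 1) / 2)) *
        (supNorm x : ℝ) ^ (-((s + 1) / 2)) := by
  obtain ⟨C, n₀, hC, hn₀, h⟩ := exists_grad_le_supNorm hs hdecay
  obtain ⟨C', hC', h'⟩ := exists_log_pow_le (show 0 < (s - 1) / 2 by linarith) r
  refine ⟨C * C', 4 * n₀, by positivity, by linarith, fun J hJ x hx => ?_⟩
  have hx' : n₀ ≤ supNorm x := by linarith
  have hJe : Real.exp 1 ≤ J := by linarith [Real.exp_one_lt_d9]
  have hx0 : (0 : ℝ) < supNorm x := by linarith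
  have hJ0 : 0 < J := by linarith
  refine (h x hx').trans ?_
  calc C * (supNorm x : ℝ) ^ (-s) * Real.log (supNorm x) ^ r
      ≤ C * (supNorm x : ℝ) ^ (-s) *
        (C' * Real.log J ^ r * ((supNorm x : ℝ) / J) ^ ((s - 1) / 2)) := by
        gcongr
        exact h' J _ hJe hx (by linarith)
    _ = _ := by
        have e : (supNorm x : ℝ) ^ (-((s + 1) / 2))
            = (supNorm x : ℝ) ^ (-s) * (supNorm x : ℝ) ^ ((s - 1) / 2) := by
          rw [← Real.rpow_add hx0]; congr 1; ring
        rw [Real.div_rpow hx0.le hJ0.le, e, Real.rpow_neg hJ0.le]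
        field_simp

/-- Pointwise and square-sum bounds for a strain outside the square of size `J / 4`, in terms of
the truncation rate. -/
theorem exists_grad_bounds (hs : 1 < s)
    (hdecay : ∃ C₀ r₀ : ℝ, ∀ x : Site k, r₀ ≤ ‖(x : ℂ)‖ →
      ‖grad R u x‖ ≤ C₀ * ‖(x : ℂ)‖ ^ (-s) * Real.log ‖(x : ℂ)‖ ^ r) :
    ∃ C J₀ : ℝ, 0 < C ∧ 4 ≤ J₀ ∧ ∀ J, J₀ ≤ J →
      (∀ x : Site k, J / 4 ≤ supNorm x → ‖grad R u x‖ ≤ C * (truncRate s r J / J)) ∧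
      ∀ S : Finset (Site k), (∀ x ∈ S, J / 4 ≤ supNorm x) →
        ∑ x ∈ S, ‖grad R u x‖ ^ 2 ≤ C * truncRate s r J ^ 2 := by
  obtain ⟨C, J₀, hC, hJ₀, h⟩ := exists_grad_le_of_annulus hs hdecay
  set A : ℝ := 4 ^ ((s + 1) / 2) with hA
  set B : ℝ := 8 * ((s + 1) / (s + 1 - 2)) * 4 ^ (s - 1) with hB
  have hs1 : 0 < s - 1 := by linarith
  have hB0 : 0 < B := by
    have : 0 < s + 1 - 2 := by linarith
    positivity
  refine ⟨C * A + C ^ 2 * B, J₀, by positivity, hJ₀, fun J hJ => ⟨fun x hx => ?_, fun S hS => ?_⟩⟩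
  · have hJ0 : 0 < J := by linarith
    have hl : 0 ≤ Real.log J := Real.log_nonneg (by linarith)
    have h1 : (supNorm x : ℝ) ^ (-((s + 1) / 2)) ≤ A * J ^ (-((s + 1) / 2)) := by
      calc (supNorm x : ℝ) ^ (-((s + 1) / 2)) ≤ (J / 4) ^ (-((s + 1) / 2)) :=
            Real.rpow_le_rpow_of_nonpos (by positivity) hx (by linarith)
        _ = _ := by
            rw [Real.div_rpow hJ0.le (by norm_num), Real.rpow_neg (by norm_num : (0:ℝ) ≤ 4), hA]
            field_simp
    have e : truncRate s r J / J
        = Real.log J ^ r * (J ^ (-((s - 1) / 2)) * J ^ (-((s + 1) / 2))) := by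
      rw [← Real.rpow_add hJ0, truncRate]
      have : -((s - 1) / 2) + -((s + 1) / 2) = 1 - s - 1 := by ring
      rw [this, Real.rpow_sub_one hJ0.ne']
      ring
    have h0 : 0 < truncRate s r J / J := div_pos (truncRate_pos (by linarith)) hJ0
    calc _ ≤ C * Real.log J ^ r * J ^ (-((s - 1) / 2)) * (A * J ^ (-((s + 1) / 2))) := by
          refine (h J hJ x hx).trans ?_
          gcongr
      _ = C * A * (truncRate s r J / J) := by rw [e]; ring
      _ ≤ _ := by
          gcongr
          have : 0 ≤ C ^ 2 * B := by positivity
          linarith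
  · have hJ0 : 0 < J := by linarith
    have h1 : ∀ x ∈ S, ‖grad R u x‖ ^ 2 ≤ C ^ 2 * (Real.log J ^ r) ^ 2 * J ^ (-(s - 1)) *
        (supNorm x : ℝ) ^ (-(s + 1)) := by
      intro x hx
      have hx0 : (0 : ℝ) < supNorm x := lt_of_lt_of_le (by positivity) (hS x hx)
      refine (pow_le_pow_left₀ (norm_nonneg _) (h J hJ x (hS x hx)) 2).trans (le_of_eq ?_)
      have e1 : J ^ (-(s - 1)) = (J ^ (-((s - 1) / 2))) ^ 2 := by
        rw [← Real.rpow_natCast, ← Real.rpow_mul hJ0.le]; congr 1; push_cast; ring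
      have e2 : (supNorm x : ℝ) ^ (-(s + 1)) = ((supNorm x : ℝ) ^ (-((s + 1) / 2))) ^ 2 := by
        rw [← Real.rpow_natCast, ← Real.rpow_mul hx0.le]; congr 1; push_cast; ring
      rw [e1, e2]; ring
    refine (Finset.sum_le_sum h1).trans ?_
    rw [← Finset.mul_sum]
    have h2 := sum_supNorm_rpow_le (α := s + 1) (by linarith) (T := J / 4) (by linarith) S hS
    have e3 : 8 * ((s + 1) / (s + 1 - 2)) * (J / 4) ^ (2 - (s + 1)) = B * J ^ (1 - s) := by
      rw [Real.div_rpow hJ0.le (by norm_num), hB]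
      have a1 : 2 - (s + 1) = 1 - s := by ring
      have a2 : (4 : ℝ) ^ (1 - s) = (4 ^ (s - 1))⁻¹ := by
        rw [← Real.rpow_neg (by norm_num)]; congr 1; ring
      rw [a1, a2]
      field_simp
    rw [e3] at h2
    calc _ ≤ C ^ 2 * (Real.log J ^ r) ^ 2 * J ^ (-(s - 1)) * (B * J ^ (1 - s)) := by gcongr
      _ = C ^ 2 * B * truncRate s r J ^ 2 := by
          rw [truncRate]
          have : -(s - 1) = 1 - s := by ring
          rw [this]; ring
      _ ≤ _ := by
          gcongr
          have : 0 ≤ C * A := by positivity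
          linarith

end Decay

/-! ### Oscillation on annuli -/

theorem abs_sub_le_of_steps {f : ℤ → ℝ} {B L : ℝ} (h : ∀ j : ℤ, (|(j : ℝ)| ≤ L) →
    |f (j + 1) - f j| ≤ B) {i j : ℤ} (hi : |(i : ℝ)| ≤ L) (hj : |(j : ℝ)| ≤ L) :
    |f i - f j| ≤ 2 * L * B := by
  wlog hij : j ≤ i generalizing i j
  · rw [abs_sub_comm]; exact this hj hi (by omega)
  have hB : 0 ≤ B := (abs_nonneg _).trans (h i hi)
  have key : ∀ i : ℤ, j ≤ i → |(i : ℝ)| ≤ L → |f i - f j| ≤ (i - j) * B := by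
    intro i hij
    induction i, hij using Int.leInduction with
    | base => intro _; simp
    | succ i hij ih =>
      intro hi
      have hi' : |(i : ℝ)| ≤ L := by
        rw [abs_le] at hi hj ⊢
        have : (j : ℝ) ≤ i := by exact_mod_cast hij
        push_cast at hi
        constructor <;> linarith
      have h1 := ih hi'
      have h2 := h i hi'
      push_cast
      calc |f (i + 1) - f j| = |(f (i + 1) - f i) + (f i - f j)| := by congr 1; ring
        _ ≤ B + (i - j) * B := (abs_add_le _ _).trans (add_le_add h2 h1)
        _ = _ := by ring
  refine (key i hij hi).trans ?_
  rw [abs_le] at hi hj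
  gcongr
  linarith

/-- Some coordinate of `x` is at least `a` in modulus. Moving the other one to `m` first, and this
one afterwards, gives a path to `(m, m)` that never leaves the square annulus. Each leg costs at
most `2 * b * B`. -/
theorem abs_sub_le_on_annulus {u : Site k → ℝ} {a b B : ℝ} {m : ℤ} (hm : a ≤ m) (hmb : m ≤ b)
    (hm0 : 0 ≤ m)
    (h : ∀ e ∈ ({(1, 0), (0, 1)} : Set (ℤ × ℤ)), ∀ x : Site k, a ≤ supNorm x → supNorm x ≤ b →
      |u (x + siteEquiv k e) - u x| ≤ B) {x : Site k} (hxa : a ≤ supNorm x)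
    (hxb : supNorm x ≤ b) : |u x - u (siteEquiv k (m, m))| ≤ 4 * b * B := by
  obtain ⟨⟨p, q⟩, rfl⟩ := (siteEquiv k).surjective x
  have hnorm : ∀ p q : ℤ, (supNorm (siteEquiv k (p, q)) : ℝ) = max |(p : ℝ)| |(q : ℝ)| := by
    intro p q
    rw [supNorm_siteEquiv]
    push_cast
    rw [Nat.cast_natAbs, Nat.cast_natAbs, Int.cast_abs, Int.cast_abs]
  have hmabs : |(m : ℝ)| = m := abs_of_nonneg (by exact_mod_cast hm0)
  rw [hnorm] at hxa hxb
  have hpb : |(p : ℝ)| ≤ b := (le_max_left _ _).trans hxb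
  have hqb : |(q : ℝ)| ≤ b := (le_max_right _ _).trans hxb
  have horiz : ∀ p p' q : ℤ, a ≤ |(q : ℝ)| → |(q : ℝ)| ≤ b → |(p : ℝ)| ≤ b → |(p' : ℝ)| ≤ b →
      |u (siteEquiv k (p, q)) - u (siteEquiv k (p', q))| ≤ 2 * b * B := by
    intro p p' q hq hq' hp hp'
    refine abs_sub_le_of_steps (f := fun j => u (siteEquiv k (j, q))) (fun j hj => ?_) hp hp'
    have := h (1, 0) (by simp) (siteEquiv k (j, q)) (by rw [hnorm]; exact hq.trans (le_max_right _ _))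
      (by rw [hnorm]; exact max_le hj hq')
    rw [← map_add] at this
    simpa using this
  have vert : ∀ p q q' : ℤ, a ≤ |(p : ℝ)| → |(p : ℝ)| ≤ b → |(q : ℝ)| ≤ b → |(q' : ℝ)| ≤ b →
      |u (siteEquiv k (p, q)) - u (siteEquiv k (p, q'))| ≤ 2 * b * B := by
    intro p q q' hp hp' hq hq'
    refine abs_sub_le_of_steps (f := fun j => u (siteEquiv k (p, j))) (fun j hj => ?_) hq hq'
    have := h (0, 1) (by simp) (siteEquiv k (p, j)) (by rw [hnorm]; exact hp.trans (le_max_left _ _))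
      (by rw [hnorm]; exact max_le hp' hj)
    rw [← map_add] at this
    simpa using this
  rcases le_max_iff.1 hxa with hp | hq
  · have h1 := vert p q m hp hpb hqb (by rwa [hmabs])
    have h2 := horiz p m m (by rwa [hmabs]) (by rwa [hmabs]) hpb (by rwa [hmabs])
    exact (abs_sub_le _ (u (siteEquiv k (p, m))) _).trans (by linarith)
  · have h1 := horiz p m q hq hqb hpb (by rwa [hmabs])
    have h2 := vert m q m (by rwa [hmabs]) (by rwa [hmabs]) hqb (by rwa [hmabs])
    exact (abs_sub_le _ (u (siteEquiv k (m, q))) _).trans (by linarith)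

/-! ### Truncation -/

/-- A piecewise linear cutoff: one on the square of size `J`, zero outside that of size `2 J`. -/
def cutoff (J : ℝ) (x : Site k) : ℝ := max (min (2 - supNorm x / J) 1) 0

theorem cutoff_eq_one {J : ℝ} (hJ : 0 < J) {x : Site k} (hx : supNorm x ≤ J) :
    cutoff J x = 1 := by
  have : (supNorm x : ℝ) / J ≤ 1 := by rwa [div_le_one hJ]
  rw [cutoff, min_eq_right (by linarith), max_eq_left zero_le_one]

theorem cutoff_eq_zero {J : ℝ} (hJ : 0 < J) {x : Site k} (hx : 2 * J ≤ supNorm x) :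
    cutoff J x = 0 := by
  have : 2 ≤ (supNorm x : ℝ) / J := by rwa [le_div_iff₀ hJ]
  rw [cutoff, max_eq_right ((min_le_left _ _).trans (by linarith))]

theorem cutoff_nonneg (J : ℝ) (x : Site k) : 0 ≤ cutoff J x := le_max_right _ _

theorem cutoff_le_one (J : ℝ) (x : Site k) : cutoff J x ≤ 1 :=
  max_le (min_le_right _ _) zero_le_one

theorem abs_supNorm_sub_le (x y : Site k) : |(supNorm (x + y) : ℝ) - supNorm x| ≤ supNorm y := by
  have h1 : (supNorm (x + y) : ℝ) ≤ supNorm x + supNorm y := by exact_mod_cast supNorm_add_le x y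
  have h2 : (supNorm x : ℝ) ≤ supNorm (x + y) + supNorm y := by
    have := supNorm_add_le (x + y) (-y)
    rw [supNorm_neg, add_neg_cancel_right] at this
    exact_mod_cast this
  rw [abs_le]
  constructor <;> linarith

theorem abs_cutoff_sub_le {J : ℝ} (hJ : 0 < J) (x y : Site k) :
    |cutoff J (x + y) - cutoff J x| ≤ supNorm y / J := by
  have h1 := abs_sup_sub_sup_le_abs (min (2 - supNorm (x + y) / J) 1)
    (min (2 - supNorm x / J) 1) 0
  have h2 := abs_inf_sub_inf_le_abs (2 - supNorm (x + y) / J) (2 - supNorm x / J) 1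
  refine (h1.trans h2).trans ?_
  have : (2 - (supNorm (x + y) : ℝ) / J) - (2 - supNorm x / J)
      = -((supNorm (x + y) - supNorm x) / J) := by ring
  rw [this, abs_neg, abs_div, abs_of_pos hJ]
  gcongr
  exact abs_supNorm_sub_le x y

theorem card_le_of_supNorm_le {b : ℝ} (hb : 0 ≤ b) (S : Finset (Site k))
    (hS : ∀ x ∈ S, (supNorm x : ℝ) ≤ b) : (S.card : ℝ) ≤ (2 * b + 1) ^ 2 := by
  set n := ⌊b⌋₊ with hn
  have h1 : S.card ≤ (Finset.Icc (-(n : ℤ)) n ×ˢ Finset.Icc (-(n : ℤ)) n).card := by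
    refine Finset.card_le_card_of_injOn (siteEquiv k).symm ?_ (siteEquiv k).symm.injective.injOn
    intro x hx
    have h2 : supNorm x ≤ n := Nat.le_floor (hS x hx)
    unfold supNorm at h2
    simp only [Finset.coe_product, mem_prod, Finset.coe_Icc, mem_Icc]
    omega
  rw [Finset.card_product, Int.card_Icc] at h1
  have h3 : ((n : ℤ) + 1 - -(n : ℤ)).toNat = 2 * n + 1 := by omega
  rw [h3] at h1
  have h4 : (S.card : ℝ) ≤ (2 * n + 1) * (2 * n + 1) := by exact_mod_cast h1
  have h5 : (n : ℝ) ≤ b := Nat.floor_le hb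
  have h6 : (0 : ℝ) ≤ n := by positivity
  nlinarith

set_option maxHeartbeats 800000 in
-- The competitor is `cutoff J * (u - a)`. Its strain error splits into the tail of the strain of
-- `u` and a term of size `|u - a| / J = O(η / J)`, carried by `O(J²)` sites. Both have `ℓ²` norm of
-- order `η`.
theorem exists_truncation {R : Finset (Site k)}
    (hR : AddSubgroup.closure (R : Set (Site k)) = ⊤) (u : HDot R) {s : ℝ} (hs : 1 < s) (r : ℕ)
    (hdecay : ∃ C₀ r₀ : ℝ, ∀ x : Site k, r₀ ≤ ‖(x : ℂ)‖ →
      ‖grad R u.1 x‖ ≤ C₀ * ‖(x : ℂ)‖ ^ (-s) * Real.log ‖(x : ℂ)‖ ^ r) :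
    ∃ C R₀ : ℝ, 0 < C ∧ 1 < R₀ ∧ ∀ ρ, R₀ ≤ ρ → ∃ v ∈ Hc R,
      (∀ x : Site k, ρ ≤ ‖(x : ℂ)‖ → v.1 x = 0) ∧ ‖v - u‖ ≤ C * truncRate s r ρ := by
  obtain ⟨C, J₀, hC, hJ₀, hb⟩ := exists_grad_bounds hs hdecay
  obtain ⟨C₁, K₁, hC₁, h₁⟩ := exists_abs_sub_le hR (siteEquiv k (1, 0))
  obtain ⟨C₂, K₂, hC₂, h₂⟩ := exists_abs_sub_le hR (siteEquiv k (0, 1))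
  set c : ℕ := R.sup supNorm with hc
  set Cs := C₁ + C₂ with hCs
  have hCs0 : 0 ≤ Cs := by positivity
  -- Makes `K₁`, `K₂` and the interaction range `c` at most `J / 4`, so that neighbours of a site
  -- beyond `J / 2` still lie beyond `J / 4`.
  set J₁ : ℝ := J₀ + 4 * K₁ + 4 * K₂ + 4 * c with hJ₁
  set D : ℝ := 2 * C + 49 * (2 * (R.card * (c * (12 * Cs * C)) ^ 2)) with hD
  have hD0 : 0 < D := by positivity
  refine ⟨Real.sqrt D * 4 ^ (s - 1), 4 * J₁, by positivity, ?_, fun ρ hρ => ?_⟩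
  · have : (0 : ℝ) ≤ 4 * K₁ + 4 * K₂ + 4 * c := by positivity
    linarith
  -- With `‖x‖ ≤ 2 * supNorm x`, a site with `‖x‖ ≥ ρ` has sup norm at least `2 * J`, where the
  -- cutoff vanishes.
  set J := ρ / 4 with hJ
  have hJJ : J₁ ≤ J := by rw [hJ]; linarith
  have hK₁ : (0 : ℝ) ≤ K₁ := by positivity
  have hK₂ : (0 : ℝ) ≤ K₂ := by positivity
  have hc0 : (0 : ℝ) ≤ c := by positivity
  have hJ0 : J₀ ≤ J := by linarith
  have hJ4 : 4 ≤ J := by linarith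
  have hJpos : 0 < J := by linarith
  obtain ⟨hpt, hsum⟩ := hb J hJ0
  set η := truncRate s r J with hη
  have hη0 : 0 < η := truncRate_pos (by linarith)
  set m : ℤ := ⌈J⌉ with hm
  set a := u.1 (siteEquiv k (m, m)) with ha
  have hm1 : J ≤ m := Int.le_ceil J
  have hm2 : (m : ℝ) < J + 1 := Int.ceil_lt_add_one J
  have hosc : ∀ x : Site k, J / 2 ≤ supNorm x → supNorm x ≤ 3 * J →
      |u.1 x - a| ≤ 12 * Cs * C * η := by
    intro x hxa hxb
    have hstep : ∀ (C' : ℝ) (K : ℕ) (e x : Site k), 0 ≤ C' → C' ≤ Cs → 4 * (K : ℝ) ≤ J →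
        (∀ (u : Site k → ℝ) (x : Site k) (B : ℝ),
          (∀ y, supNorm y ≤ K → ‖grad R u (x + y)‖ ≤ B) → |u (x + e) - u x| ≤ C' * B) →
        J / 2 ≤ supNorm x → |u.1 (x + e) - u.1 x| ≤ Cs * (C * (η / J)) := by
      intro C' K e x h0 hC' hK h hx
      have : 0 ≤ C * (η / J) := by positivity
      refine (h u.1 x (C * (η / J)) fun y hy => hpt _ ?_).trans (by gcongr)
      have h3 := (abs_le.1 (abs_supNorm_sub_le x y)).1
      have h4 : (supNorm y : ℝ) ≤ K := by exact_mod_cast hy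
      linarith
    have := abs_sub_le_on_annulus (u := u.1) (a := J / 2) (b := 3 * J) (B := Cs * (C * (η / J)))
      (m := m) (by linarith) (by linarith) (Int.ceil_nonneg hJpos.le) (by
        intro e he x hxa _
        rcases he with rfl | he
        · exact hstep C₁ K₁ _ x hC₁ (by linarith) (by linarith) h₁ hxa
        · rw [mem_singleton_iff] at he
          subst he
          exact hstep C₂ K₂ _ x hC₂ (by linarith) (by linarith) h₂ hxa) hxa hxb
    refine this.trans (le_of_eq ?_)
    field_simp
    ring
  have hfin : (Function.support fun x => cutoff J x * (u.1 x - a)).Finite := by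
    refine (finite_supNorm_le k ⌈2 * J⌉₊).subset fun x hx => ?_
    by_contra h
    apply hx
    have h5 : ⌈2 * J⌉₊ < supNorm x := not_le.1 h
    have h6 : 2 * J ≤ supNorm x := (Nat.le_ceil _).trans (by exact_mod_cast h5.le)
    simp [cutoff_eq_zero hJpos h6]
  refine ⟨ofFinite R _ hfin, hfin, fun x hx => ?_, ?_⟩
  · have h6 : 2 * J ≤ supNorm x := by
      have := norm_le_supNorm x
      rw [hJ]; linarith
    change cutoff J x * (u.1 x - a) = 0
    rw [cutoff_eq_zero hJpos h6, zero_mul]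
  set w := ofFinite R _ hfin - u with hw
  have hwx : ∀ x, w.1 x = cutoff J x * (u.1 x - a) - u.1 x := fun x => rfl
  classical
  have hcomp : ∀ (x : Site k) (ρ : R), (grad R w.1 x ρ) ^ 2 ≤
      (if J / 4 ≤ supNorm x then 2 * (grad R u.1 x ρ) ^ 2 else 0)
      + (if (supNorm x : ℝ) ≤ 3 * J then 2 * (c * (12 * Cs * C) * (η / J)) ^ 2 else 0) := by
    intro x ρ
    have hρc : (supNorm ρ.1 : ℝ) ≤ c := by
      exact_mod_cast Finset.le_sup (f := supNorm) ρ.2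
    have hdiff := abs_le.1 (abs_supNorm_sub_le x ρ.1)
    -- Discrete product rule. The first term vanishes inside `J / 4`, the second outside the annulus
    -- between `J / 2` and `3 * J`.
    have e : grad R w.1 x ρ = (cutoff J (x + ρ.1) - 1) * grad R u.1 x ρ
        + (cutoff J (x + ρ.1) - cutoff J x) * (u.1 x - a) := by
      simp only [grad, hwx]
      ring
    have t1 : ((cutoff J (x + ρ.1) - 1) * grad R u.1 x ρ) ^ 2 ≤
        if J / 4 ≤ supNorm x then (grad R u.1 x ρ) ^ 2 else 0 := by
      split_ifs with h
      · rw [mul_pow]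
        have b1 := cutoff_nonneg J (x + ρ.1)
        have b2 := cutoff_le_one J (x + ρ.1)
        have : (cutoff J (x + ρ.1) - 1) ^ 2 ≤ 1 := by nlinarith
        exact mul_le_of_le_one_left (sq_nonneg _) this
      · rw [cutoff_eq_one hJpos (by linarith)]
        simp
    have t2 : ((cutoff J (x + ρ.1) - cutoff J x) * (u.1 x - a)) ^ 2 ≤
        if (supNorm x : ℝ) ≤ 3 * J then (c * (12 * Cs * C) * (η / J)) ^ 2 else 0 := by
      split_ifs with h
      · by_cases h' : J / 2 ≤ supNorm x
        · rw [← sq_abs, abs_mul]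
          refine pow_le_pow_left₀ (by positivity) ?_ 2
          calc _ ≤ (c / J) * (12 * Cs * C * η) :=
                mul_le_mul ((abs_cutoff_sub_le hJpos x ρ.1).trans (by gcongr))
                  (hosc x h' h) (abs_nonneg _) (by positivity)
            _ = _ := by ring
        · rw [cutoff_eq_one hJpos (by linarith), cutoff_eq_one hJpos (by linarith)]
          rw [sub_self, zero_mul, zero_pow two_ne_zero]
          positivity
      · rw [cutoff_eq_zero hJpos (by linarith), cutoff_eq_zero hJpos (by linarith)]
        simp
    rw [e]
    refine add_sq_le.trans ?_
    rw [mul_add]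
    refine add_le_add ?_ ?_
    · split_ifs at t1 ⊢ <;> linarith
    · split_ifs at t2 ⊢ <;> linarith
  have hnorm : ∀ x : Site k, ‖grad R w.1 x‖ ^ 2 ≤
      (if J / 4 ≤ supNorm x then 2 * ‖grad R u.1 x‖ ^ 2 else 0)
      + (if (supNorm x : ℝ) ≤ 3 * J then
          R.card * (2 * (c * (12 * Cs * C) * (η / J)) ^ 2) else 0) := by
    intro x
    rw [EuclideanSpace.real_norm_sq_eq, EuclideanSpace.real_norm_sq_eq]
    refine (Finset.sum_le_sum fun ρ _ => hcomp x ρ).trans (le_of_eq ?_)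
    rw [Finset.sum_add_distrib]
    congr 1
    · split_ifs
      · rw [Finset.mul_sum]
      · simp
    · split_ifs
      · simp
      · simp
  have htot : ‖w‖ ^ 2 ≤ D * η ^ 2 := by
    rw [← norm_gradL, ← lp_tsum_sq]
    refine (lp_summable_sq (gradL R w)).tsum_le_of_sum_le fun S => ?_
    refine (Finset.sum_le_sum fun x _ => hnorm x).trans ?_
    rw [Finset.sum_add_distrib, ← Finset.sum_filter, ← Finset.sum_filter, ← Finset.mul_sum,
      Finset.sum_const, nsmul_eq_mul]
    have b1 := hsum (S.filter fun x => J / 4 ≤ supNorm x) fun x hx => (Finset.mem_filter.1 hx).2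
    have b2 := card_le_of_supNorm_le (b := 3 * J) (by linarith)
      (S.filter fun x => (supNorm x : ℝ) ≤ 3 * J) fun x hx => (Finset.mem_filter.1 hx).2
    have b3 : (2 * (3 * J) + 1) ^ 2 ≤ 49 * J ^ 2 := by nlinarith
    calc _ ≤ 2 * (C * η ^ 2) + 49 * J ^ 2 * (R.card * (2 * (c * (12 * Cs * C) * (η / J)) ^ 2)) :=
          add_le_add (by gcongr) (mul_le_mul_of_nonneg_right (b2.trans b3) (by positivity))
      _ = _ := by rw [hD]; field_simp
  have hrate : η ≤ 4 ^ (s - 1) * truncRate s r ρ := by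
    have hρ0 : 0 < ρ := by linarith
    rw [hη, truncRate, truncRate, hJ, Real.div_rpow hρ0.le (by norm_num)]
    have a2 : (4 : ℝ) ^ (1 - s) = (4 ^ (s - 1))⁻¹ := by
      rw [← Real.rpow_neg (by norm_num)]; congr 1; ring
    have a3 : Real.log (ρ / 4) ≤ Real.log ρ := Real.log_le_log hJpos (by linarith)
    have a4 : 0 ≤ Real.log (ρ / 4) := Real.log_nonneg (by linarith)
    rw [a2, div_inv_eq_mul, mul_comm (ρ ^ (1 - s)), mul_assoc]
    gcongr
  have hfinal : ‖w‖ ≤ Real.sqrt D * η := by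
    refine le_of_sq_le_sq ?_ (by positivity)
    rw [mul_pow, Real.sq_sqrt hD0.le]
    exact htot
  calc ‖w‖ ≤ Real.sqrt D * η := hfinal
    _ ≤ Real.sqrt D * (4 ^ (s - 1) * truncRate s r ρ) := by gcongr
    _ = _ := by ring

/-! ### Forces that are bounded functionals on the energy space -/

section Forces

variable (R : Finset (Site k))

theorem summable_mul_Hc {v : HDot R} (hv : v ∈ Hc R) (c : Site k → ℝ) :
    Summable fun x => c x * v.1 x :=
  summable_of_hasFiniteSupport (hv.subset fun x hx hx' => hx (by
    simp only [hx', mul_zero]))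

/-- The forces whose pairing with compactly supported displacements is bounded in the energy
norm. -/
def bddForces : Submodule ℝ (Site k → ℝ) where
  carrier := {c | ∃ C, 0 ≤ C ∧ ∀ v ∈ Hc R, |∑' x, c x * v.1 x| ≤ C * ‖v‖}
  zero_mem' := ⟨0, le_rfl, fun v _ => by simp⟩
  add_mem' := by
    rintro c d ⟨C, hC, h⟩ ⟨D, hD, h'⟩
    refine ⟨C + D, by positivity, fun v hv => ?_⟩
    have : ∑' x, (c + d) x * v.1 x = ∑' x, c x * v.1 x + ∑' x, d x * v.1 x := by
      rw [← (summable_mul_Hc R hv c).tsum_add (summable_mul_Hc R hv d)]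
      exact tsum_congr fun x => by rw [Pi.add_apply]; ring
    rw [this, add_mul]
    exact (abs_add_le _ _).trans (add_le_add (h v hv) (h' v hv))
  smul_mem' := by
    rintro t c ⟨C, hC, h⟩
    refine ⟨|t| * C, by positivity, fun v hv => ?_⟩
    have : ∑' x, (t • c) x * v.1 x = t * ∑' x, c x * v.1 x := by
      rw [← tsum_mul_left]
      exact tsum_congr fun x => by rw [Pi.smul_apply, smul_eq_mul]; ring
    rw [this, abs_mul, mul_assoc]
    exact mul_le_mul_of_nonneg_left (h v hv) (abs_nonneg _)

/-- The force generated by the stress `f` acting on the bonds in direction `e`. -/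
def divBond (e : Site k) : (Site k → ℝ) →ₗ[ℝ] (Site k → ℝ) where
  toFun f x := f (x - e) - f x
  map_add' f g := by funext x; simp; ring
  map_smul' t f := by funext x; simp; ring

theorem divBond_apply (e : Site k) (f : Site k → ℝ) (x : Site k) :
    divBond e f x = f (x - e) - f x := rfl

variable {R}

/-- Summation by parts. -/
theorem tsum_divBond_mul (e : Site k) (f : Site k → ℝ) {v : HDot R} (hv : v ∈ Hc R) :
    ∑' x, divBond e f x * v.1 x = ∑' x, f x * (v.1 (x + e) - v.1 x) := by
  have s1 : Summable fun x => f (x - e) * v.1 x := summable_mul_Hc R hv fun x => f (x - e)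
  have s2 := summable_mul_Hc R hv f
  have s3 : Summable fun x => f x * v.1 (x + e) := by
    have := (Equiv.addRight e).summable_iff.2 s1
    simpa only [Function.comp_def, Equiv.coe_addRight, add_sub_cancel_right] using this
  have t1 : ∑' x, f x * v.1 (x + e) = ∑' x, f (x - e) * v.1 x := by
    have := (Equiv.addRight e).tsum_eq fun x => f (x - e) * v.1 x
    simpa only [Equiv.coe_addRight, add_sub_cancel_right] using this
  calc _ = ∑' x, (f (x - e) * v.1 x - f x * v.1 x) :=
        tsum_congr fun x => by rw [divBond_apply]; ring
    _ = ∑' x, (f x * v.1 (x + e) - f x * v.1 x) := by rw [s1.tsum_sub s2, s3.tsum_sub s2, t1]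
    _ = _ := tsum_congr fun x => by ring

theorem divBond_mem_bddForces (hR : AddSubgroup.closure (R : Set (Site k)) = ⊤) (e : Site k)
    {f : Site k → ℝ} (hf : Summable fun x => f x ^ 2) : divBond e f ∈ bddForces R := by
  obtain ⟨C, hC, h⟩ := exists_summable_sub_sq hR e
  refine ⟨Real.sqrt (∑' x, f x ^ 2) * Real.sqrt C, by positivity, fun v hv => ?_⟩
  obtain ⟨s, t⟩ := h v
  rw [tsum_divBond_mul e f hv]
  let F : lp (fun _ : Site k => ℝ) 2 := ⟨f, memℓp_gen (by simpa using hf)⟩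
  let G : lp (fun _ : Site k => ℝ) 2 :=
    ⟨fun x => v.1 (x + e) - v.1 x, memℓp_gen (by simpa using s)⟩
  have h1 := norm_tsum_le_of_le_mul (f := fun x => f x * (v.1 (x + e) - v.1 x)) zero_le_one F G
    fun x => by rw [one_mul, norm_mul]
  have hF : ‖F‖ = Real.sqrt (∑' x, f x ^ 2) := by
    rw [eq_comm, Real.sqrt_eq_iff_mul_self_eq (tsum_nonneg fun x => sq_nonneg _) (norm_nonneg _),
      ← sq, ← lp_tsum_sq]
    exact tsum_congr fun x => by simp [F]
  have hG : ‖G‖ ≤ Real.sqrt C * ‖v‖ := by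
    refine le_of_sq_le_sq ?_ (by positivity)
    rw [mul_pow, Real.sq_sqrt hC, ← lp_tsum_sq]
    refine (le_of_eq ?_).trans t
    exact tsum_congr fun x => by simp [G]
  rw [one_mul, hF] at h1
  rw [← Real.norm_eq_abs]
  refine h1.trans ?_
  rw [mul_assoc]
  gcongr

/-- Square-summable stresses generate bounded forces by Cauchy–Schwarz, so in the quotient a stress
counts only modulo `ℓ²`. -/
theorem mkQ_divBond_eq_of_summable (hR : AddSubgroup.closure (R : Set (Site k)) = ⊤) (e : Site k)
    {f g : Site k → ℝ} (h : Summable fun x => (f x - g x) ^ 2) :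
    (bddForces R).mkQ (divBond e f) = (bddForces R).mkQ (divBond e g) := by
  rw [← sub_eq_zero, ← map_sub, ← map_sub]
  exact (Submodule.Quotient.mk_eq_zero _).2 (divBond_mem_bddForces hR e h)

/-- Modulo bounded forces, the force of a slowly varying stress is additive in the direction of
the bonds. -/
theorem mkQ_divBond_siteEquiv (hR : AddSubgroup.closure (R : Set (Site k)) = ⊤)
    {f : Site k → ℝ} (hf : ∀ e, Summable fun x => (divBond e f x) ^ 2) (p : ℤ × ℤ) :
    (bddForces R).mkQ (divBond (siteEquiv k p) f)
      = (p.1 : ℝ) • (bddForces R).mkQ (divBond (siteEquiv k (1, 0)) f)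
        + (p.2 : ℝ) • (bddForces R).mkQ (divBond (siteEquiv k (0, 1)) f) := by
  let Φ : ℤ × ℤ →+ (Site k → ℝ) ⧸ bddForces R :=
    AddMonoidHom.mk' (fun p => (bddForces R).mkQ (divBond (siteEquiv k p) f)) (by
      intro p q
      rw [← map_add, ← sub_eq_zero, ← map_sub]
      -- The failure of additivity is a second difference of `f`, that is, the divergence of an `ℓ²`
      -- stress.
      have : divBond (siteEquiv k (p + q)) f
          - (divBond (siteEquiv k p) f + divBond (siteEquiv k q) f)
          = divBond (siteEquiv k q) (divBond (siteEquiv k p) f) := by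
        funext x
        simp only [Pi.sub_apply, Pi.add_apply, divBond_apply, map_add]
        have : x - (siteEquiv k p + siteEquiv k q) = x - siteEquiv k q - siteEquiv k p := by abel
        rw [this]
        ring
      rw [this]
      exact (Submodule.Quotient.mk_eq_zero _).2 (divBond_mem_bddForces hR _ (hf _)))
  have h : p = p.1 • ((1, 0) : ℤ × ℤ) + p.2 • ((0, 1) : ℤ × ℤ) := by ext <;> simp
  have h2 : Φ p = p.1 • Φ (1, 0) + p.2 • Φ (0, 1) := by
    conv_lhs => rw [h]
    rw [map_add, map_zsmul, map_zsmul]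
  rw [Int.cast_smul_eq_zsmul, Int.cast_smul_eq_zsmul]
  exact h2

end Forces

/-! ### Asymptotics relative to the core -/

section Asymptotics

open Asymptotics

variable (xhat : ℂ)

/-- The position relative to the core. -/
def rel (x : Site k) : ℂ := (x : ℂ) - xhat

theorem rel_add (x e : Site k) : rel xhat (x + e) = rel xhat x + e := by
  simp [rel]; ring

theorem rel_sub (x e : Site k) : rel xhat (x - e) = rel xhat x - e := by
  simp [rel]; ring

theorem tendsto_norm_rel : Tendsto (fun x : Site k => ‖rel xhat x‖) cofinite atTop := by
  refine tendsto_atTop_mono (f := fun x : Site k => ‖(x : ℂ)‖ - ‖xhat‖)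
    (fun x => norm_sub_norm_le _ _) ?_
  exact tendsto_atTop_add_const_right _ _ (tendsto_norm_cofinite k)

/-- In the plane `|z|⁻⁴` is summable, so errors of order `|z|⁻²` are negligible in the quotient,
while `|z|⁻¹` is not. -/
theorem summable_sq_of_isBigO {f : Site k → ℝ}
    (hf : f =O[cofinite] fun x => ‖rel xhat x‖⁻¹ ^ 2) : Summable fun x => f x ^ 2 := by
  have h1 : Summable fun x : Site k => ‖(x : ℂ)‖ ^ (-4 : ℝ) :=
    summable_norm_rpow (by norm_num)
  refine summable_of_isBigO h1 ((hf.pow 2).trans ?_)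
  refine IsBigO.of_bound 16 ?_
  filter_upwards [(tendsto_norm_cofinite k).eventually_gt_atTop (2 * ‖xhat‖)] with x hx
  have hx0 : 0 < ‖(x : ℂ)‖ := by linarith [norm_nonneg xhat]
  have h2 : ‖(x : ℂ)‖ / 2 ≤ ‖rel xhat x‖ := by
    have := norm_sub_norm_le (x : ℂ) xhat
    unfold rel
    linarith
  have h3 : ‖(x : ℂ)‖ ^ (-4 : ℝ) = ‖(x : ℂ)‖⁻¹ ^ 4 := by
    rw [Real.rpow_neg hx0.le]
    norm_cast
    rw [inv_pow]
  have h4 : ‖rel xhat x‖⁻¹ ≤ 2 * ‖(x : ℂ)‖⁻¹ := by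
    rw [← div_eq_mul_inv, ← inv_div]
    gcongr
  rw [h3, Real.norm_of_nonneg (by positivity), Real.norm_of_nonneg (by positivity), ← pow_mul]
  calc ‖rel xhat x‖⁻¹ ^ (2 * 2) ≤ (2 * ‖(x : ℂ)‖⁻¹) ^ 4 := by gcongr
    _ = _ := by ring

theorem isBigO_inv_rel_sub (e : Site k) :
    (fun x : Site k => (rel xhat (x - e))⁻¹ - (rel xhat x)⁻¹)
      =O[cofinite] fun x => ‖rel xhat x‖⁻¹ ^ 2 := by
  refine IsBigO.of_bound (2 * ‖(e : ℂ)‖) ?_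
  filter_upwards [(tendsto_norm_rel xhat).eventually_gt_atTop (2 * ‖(e : ℂ)‖)] with x hx
  have hz0 : 0 < ‖rel xhat x‖ := by linarith [norm_nonneg (e : ℂ)]
  have h2 : ‖rel xhat x‖ / 2 ≤ ‖rel xhat (x - e)‖ := by
    have := norm_sub_norm_le (rel xhat x) (e : ℂ)
    rw [rel_sub]
    linarith
  have hz : rel xhat x ≠ 0 := norm_pos_iff.1 hz0
  have hz' : rel xhat (x - e) ≠ 0 := norm_pos_iff.1 (lt_of_lt_of_le (by positivity) h2)
  rw [inv_sub_inv hz' hz]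
  have : rel xhat x - rel xhat (x - e) = e := by rw [rel_sub]; ring
  rw [this, norm_div, norm_mul, Real.norm_of_nonneg (by positivity), div_le_iff₀ (by positivity)]
  calc ‖(e : ℂ)‖ = 2 * ‖(e : ℂ)‖ * ‖rel xhat x‖⁻¹ ^ 2 * (‖rel xhat x‖ / 2 * ‖rel xhat x‖) := by
        field_simp
    _ ≤ _ := by gcongr

theorem isBigO_log_sub (e : Site k) :
    (fun x : Site k => Complex.log (1 + e / rel xhat x) - e / rel xhat x)
      =O[cofinite] fun x => ‖rel xhat x‖⁻¹ ^ 2 := by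
  refine IsBigO.of_bound (‖(e : ℂ)‖ ^ 2) ?_
  filter_upwards [(tendsto_norm_rel xhat).eventually_gt_atTop (2 * ‖(e : ℂ)‖)] with x hx
  have hz0 : 0 < ‖rel xhat x‖ := by linarith [norm_nonneg (e : ℂ)]
  have h1 : ‖(e : ℂ) / rel xhat x‖ ≤ 1 / 2 := by
    rw [norm_div, div_le_iff₀ hz0]
    linarith
  refine (Complex.norm_log_one_add_sub_self_le (by linarith)).trans ?_
  have h2 : (1 - ‖(e : ℂ) / rel xhat x‖)⁻¹ ≤ 2 := by
    rw [inv_le_comm₀ (by linarith) (by norm_num)]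
    linarith
  rw [Real.norm_of_nonneg (by positivity), ← mul_pow, ← div_eq_mul_inv ‖(e : ℂ)‖, ← norm_div]
  calc _ ≤ ‖(e : ℂ) / rel xhat x‖ ^ 2 * 2 / 2 := by gcongr
    _ = _ := by ring

theorem isBigO_div_rel (e : Site k) :
    (fun x : Site k => (e : ℂ) / rel xhat x) =O[cofinite] fun x => ‖rel xhat x‖⁻¹ :=
  IsBigO.of_bound ‖(e : ℂ)‖ (Eventually.of_forall fun x => by simp [div_eq_mul_inv])

theorem isBigO_re {f : Site k → ℂ} {g : Site k → ℝ} (h : f =O[cofinite] g) :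
    (fun x => (f x).re) =O[cofinite] g :=
  (IsBigO.of_bound 1 (Eventually.of_forall fun x => by
    simpa using Complex.abs_re_le_norm (f x))).trans h

theorem isBigO_im {f : Site k → ℂ} {g : Site k → ℝ} (h : f =O[cofinite] g) :
    (fun x => (f x).im) =O[cofinite] g :=
  (IsBigO.of_bound 1 (Eventually.of_forall fun x => by
    simpa using Complex.abs_im_le_norm (f x))).trans h

/-- The component `Im (c / z)` of the conjugate linear elastic strain. -/
def imInv (c : ℂ) (x : Site k) : ℝ := (c * (rel xhat x)⁻¹).im

theorem summable_divBond_imInv (c : ℂ) (e : Site k) :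
    Summable fun x => (divBond e (imInv xhat c) x) ^ 2 := by
  apply summable_sq_of_isBigO xhat
  have := isBigO_im ((isBigO_inv_rel_sub xhat e).const_mul_left c)
  refine this.congr_left fun x => ?_
  rw [divBond_apply, imInv, imInv, ← Complex.sub_im]
  congr 1; ring

/-- The real part of `e / z` is, up to a square-summable error, a difference of `log ‖z‖`. -/
theorem isBigO_log_norm (hx : xhat ∉ lattice k) (e : Site k) :
    (fun x : Site k => (Real.log ‖rel xhat (x + e)‖ - Real.log ‖rel xhat x‖)
      - ((e : ℂ) / rel xhat x).re) =O[cofinite] fun x => ‖rel xhat x‖⁻¹ ^ 2 := by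
  refine (isBigO_re (isBigO_log_sub xhat e)).congr_left fun x => ?_
  have hz : ∀ x : Site k, rel xhat x ≠ 0 := fun x h => hx (by
    rw [← sub_eq_zero.1 h]; exact x.2)
  rw [Complex.sub_re, Complex.log_re]
  have : 1 + (e : ℂ) / rel xhat x = rel xhat (x + e) / rel xhat x := by
    rw [rel_add, add_div, div_self (hz x)]
  rw [this, norm_div, Real.log_div (norm_ne_zero_iff.2 (hz _)) (norm_ne_zero_iff.2 (hz _))]

end Asymptotics

/-! ### The null Lagrangian -/

/-- Both sides are the same mixed second difference of `g`. -/
theorem divBond_log_identity (g : Site k → ℝ) (e f : Site k) :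
    divBond f (fun x => g (x + e) - g x) = divBond e (fun x => g (x + e) - g (x + e - f)) := by
  funext x
  simp only [divBond_apply]
  have h1 : x - f + e = x + e - f := by abel
  rw [h1, sub_add_cancel]
  ring

/-- Modulo `ℓ²`, `Re (e / z)` is the difference of `log |z|` along `e`, and likewise for `f`; finite
differences commute. On the right the difference along `f` is taken backwards from `x + e`, which
makes the identity exact. -/
theorem mkQ_divBond_cauchyRiemann {R : Finset (Site k)}
    (hR : AddSubgroup.closure (R : Set (Site k)) = ⊤) {xhat : ℂ} (hx : xhat ∉ lattice k)
    (e f : Site k) :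
    (bddForces R).mkQ (divBond f fun x => ((e : ℂ) / rel xhat x).re)
      = (bddForces R).mkQ (divBond e fun x => ((f : ℂ) / rel xhat x).re) := by
  set g : Site k → ℝ := fun x => Real.log ‖rel xhat x‖ with hg
  have h1 := mkQ_divBond_eq_of_summable hR f (summable_sq_of_isBigO xhat (isBigO_log_norm xhat hx e))
  have h2 := mkQ_divBond_eq_of_summable hR e
    (f := fun x => g (x + e) - g (x + e - f)) (g := fun x => ((f : ℂ) / rel xhat x).re) (by
      apply summable_sq_of_isBigO xhat
      have a1 := isBigO_log_norm xhat hx e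
      have a2 := isBigO_log_norm xhat hx (e - f)
      refine (a1.sub a2).congr_left fun x => ?_
      simp only [hg]
      have e1 : x + (e - f) = x + e - f := by abel
      rw [e1]
      have e2 : (((e - f : Site k) : ℂ) / rel xhat x).re
          = ((e : ℂ) / rel xhat x).re - ((f : ℂ) / rel xhat x).re := by
        rw [← Complex.sub_re, ← sub_div]; rfl
      rw [e2]
      ring)
  rw [← h1, ← h2]
  exact congrArg _ (divBond_log_identity g e f)

/-! ### Rotational symmetry of the harmonic coefficients -/

section Symmetry

variable {R : Finset (Site k)}

open scoped Classical in
/-- The harmonic interaction coefficients. -/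
def coeff (V : EuclideanSpace ℝ R → ℝ) (ρ σ : R) : ℝ :=
  fderiv ℝ (fderiv ℝ V) 0 (EuclideanSpace.single ρ 1) (EuclideanSpace.single σ 1)

theorem coeff_symm {V : EuclideanSpace ℝ R → ℝ} (hV : ContDiff ℝ 2 V) (ρ σ : R) :
    coeff V ρ σ = coeff V σ ρ :=
  (hV.contDiffAt.isSymmSndFDerivAt (by simp)).eq _ _

/-- Differentiate `V = V ∘ T` twice at the fixed point `0` of the linear permutation map `T`. -/
theorem coeff_perm {V : EuclideanSpace ℝ R → ℝ} (hV : ContDiff ℝ 2 V) (π : Equiv.Perm R)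
    (hπ : ∀ A : EuclideanSpace ℝ R, V A = V (WithLp.toLp 2 fun ρ => A (π ρ))) (ρ σ : R) :
    coeff V (π ρ) (π σ) = coeff V ρ σ := by
  classical
  let T₀ : EuclideanSpace ℝ R →ₗ[ℝ] EuclideanSpace ℝ R :=
    { toFun := fun A => WithLp.toLp 2 fun ρ => A (π ρ)
      map_add' := fun A B => by ext; simp
      map_smul' := fun t A => by ext; simp }
  let T : EuclideanSpace ℝ R →L[ℝ] EuclideanSpace ℝ R := LinearMap.toContinuousLinearMap T₀
  have hT : ∀ A, V A = V (T A) := hπ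
  have hT1 : ∀ ρ : R, T (EuclideanSpace.single (π ρ) 1) = EuclideanSpace.single ρ 1 := by
    intro ρ
    ext σ
    change EuclideanSpace.single (π ρ) (1 : ℝ) (π σ) = _
    simp
  have hd : Differentiable ℝ V := hV.differentiable (by norm_num)
  have hd' : Differentiable ℝ (fderiv ℝ V) :=
    (hV.fderiv_right (m := 1) (by norm_num)).differentiable (by norm_num)
  have h1 : ∀ A B, fderiv ℝ V A B = fderiv ℝ V (T A) (T B) := by
    intro A B
    have e : V = V ∘ T := funext hT
    conv_lhs => rw [e]
    rw [fderiv_comp A (hd _) T.differentiableAt]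
    simp
  have h2 : ∀ B C, fderiv ℝ (fderiv ℝ V) 0 B C = fderiv ℝ (fderiv ℝ V) 0 (T B) (T C) := by
    intro B C
    have a1 : HasFDerivAt (fun A => fderiv ℝ V A C)
        ((fderiv ℝ (fderiv ℝ V) 0).flip C) 0 := by
      have := (hd' 0).hasFDerivAt.clm_apply (hasFDerivAt_const C 0)
      refine this.congr_fderiv ?_
      ext D; simp
    have a2 : HasFDerivAt (fun A => fderiv ℝ V (T A) (T C))
        (((fderiv ℝ (fderiv ℝ V) 0).flip (T C)).comp T) 0 := by
      have b1 : HasFDerivAt (fun A => fderiv ℝ V A) (fderiv ℝ (fderiv ℝ V) 0) (T 0) := by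
        rw [map_zero]; exact (hd' 0).hasFDerivAt
      have := (b1.comp 0 T.hasFDerivAt).clm_apply (hasFDerivAt_const (T C) 0)
      refine this.congr_fderiv ?_
      ext D; simp
    have e : (fun A => fderiv ℝ V A C) = fun A => fderiv ℝ V (T A) (T C) :=
      funext fun A => h1 A C
    rw [e] at a1
    have := DFunLike.congr_fun (a1.unique a2) B
    simpa using this
  unfold coeff
  rw [h2, hT1, hT1]

theorem LatticeKind.rot_sq_ne_one (k : LatticeKind) : k.rot ^ 2 ≠ 1 := by
  intro h
  cases k
  · have := congrArg Complex.re h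
    simp [LatticeKind.rot, sq] at this
    norm_num at this
  · have := congrArg Complex.im h
    simp [LatticeKind.rot, sq] at this
    linarith [Real.sqrt_pos.2 (show (0 : ℝ) < 3 by norm_num)]

/-- The complex stress coefficient of the bond direction `σ`. -/
def stressCoeff (V : EuclideanSpace ℝ R → ℝ) (σ : R) : ℂ := ∑ ρ : R, (coeff V ρ σ : ℂ) * (ρ : Site k)

/-- The sum is quadratic in the bond vectors, so reindexing by the rotation multiplies it by `rot ^
2`, which is not `1`. This is where lattice symmetry forces an isotropic linear response. -/
theorem sum_stressCoeff_mul {V : EuclideanSpace ℝ R → ℝ} (hV : ContDiff ℝ 2 V)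
    (h : ∃ π : Equiv.Perm R, (∀ ρ : R, ((π ρ : Site k) : ℂ) = k.rot * ((ρ : Site k) : ℂ)) ∧
      ∀ A : EuclideanSpace ℝ R, V A = V (WithLp.toLp 2 fun ρ => A (π ρ))) :
    ∑ σ : R, stressCoeff V σ * ((σ : Site k) : ℂ) = 0 := by
  obtain ⟨π, hrot, hπ⟩ := h
  set S := ∑ σ : R, stressCoeff V σ * ((σ : Site k) : ℂ) with hS
  have h1 : ∀ σ, stressCoeff V (π σ) = k.rot * stressCoeff V σ := by
    intro σ
    rw [stressCoeff, ← Equiv.sum_comp π, stressCoeff, Finset.mul_sum]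
    refine Finset.sum_congr rfl fun ρ _ => ?_
    rw [coeff_perm hV π hπ, hrot]
    ring
  have h2 : S = k.rot ^ 2 * S := by
    conv_lhs => rw [hS, ← Equiv.sum_comp π]
    rw [hS, Finset.mul_sum]
    refine Finset.sum_congr rfl fun σ _ => ?_
    rw [h1, hrot]
    ring
  have h3 : (1 - k.rot ^ 2) * S = 0 := by linear_combination h2
  rcases mul_eq_zero.1 h3 with h | h
  · exact absurd (sub_eq_zero.1 h).symm k.rot_sq_ne_one
  · exact h

/-- Complex conjugation swaps the two bond indices, and the coefficients are symmetric. -/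
theorem im_sum_stressCoeff_mul_conj {V : EuclideanSpace ℝ R → ℝ} (hV : ContDiff ℝ 2 V) :
    (∑ σ : R, stressCoeff V σ * (starRingEnd ℂ) ((σ : Site k) : ℂ)).im = 0 := by
  rw [← Complex.conj_eq_iff_im, map_sum]
  simp only [stressCoeff, map_mul, map_sum, Complex.conj_conj, Complex.conj_ofReal,
    Finset.sum_mul]
  rw [Finset.sum_comm]
  refine Finset.sum_congr rfl fun ρ _ => Finset.sum_congr rfl fun σ _ => ?_
  rw [coeff_symm hV]
  ring

end Symmetry

/-! ### The linearized residual of the far-field predictor -/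

section Linear

variable {R : Finset (Site k)}

theorem coe_site_eq (x : Site k) : (x : ℂ) =
    (((siteEquiv k).symm x).1 : ℂ) + ((siteEquiv k).symm x).2 * k.tau := by
  rw [← siteEquiv_coe, AddEquiv.apply_symm_apply]

/-- `imInv` as a linear map in the coefficient. -/
def imInvL (xhat : ℂ) : ℂ →ₗ[ℝ] (Site k → ℝ) where
  toFun c := imInv xhat c
  map_add' c d := by funext x; simp [imInv]; ring
  map_smul' t c := by funext x; simp [imInv]; ring

/-- Splitting each bond along `1` and `tau` leaves two stresses `Im (α / z)` and `Im (β / z)`. The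
hypotheses give `α = -β τ` with `β` purely imaginary, so they are opposite real multiples of `Re (τ
/ z)` and `Re (1 / z)`, whose divergences cancel by `mkQ_divBond_cauchyRiemann`. -/
theorem sum_divBond_imInv_mem {a : R → ℂ} (hR : AddSubgroup.closure (R : Set (Site k)) = ⊤)
    {xhat : ℂ} (hx : xhat ∉ lattice k)
    (h1 : ∑ σ : R, a σ * ((σ : Site k) : ℂ) = 0)
    (h2 : (∑ σ : R, a σ * (starRingEnd ℂ) ((σ : Site k) : ℂ)).im = 0) :
    ∑ σ : R, divBond (σ : Site k) (imInv xhat (a σ)) ∈ bddForces R := by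
  set m : R → ℝ := fun σ => (((siteEquiv k).symm σ).1 : ℝ) with hm
  set n : R → ℝ := fun σ => (((siteEquiv k).symm σ).2 : ℝ) with hn
  have hσ : ∀ σ : R, ((σ : Site k) : ℂ) = m σ + n σ * k.tau := by
    intro σ
    rw [coe_site_eq]; simp [hm, hn]
  set α : ℂ := ∑ σ : R, m σ • a σ with hα
  set β : ℂ := ∑ σ : R, n σ • a σ with hβ
  have e1 : α = -β * k.tau := by
    have : ∑ σ : R, a σ * ((σ : Site k) : ℂ) = α + β * k.tau := by
      rw [hα, hβ, Finset.sum_mul, ← Finset.sum_add_distrib]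
      refine Finset.sum_congr rfl fun σ _ => ?_
      rw [hσ, Complex.real_smul, Complex.real_smul]; ring
    rw [this] at h1
    linear_combination h1
  -- Given `α = -β τ`, the second sum equals `β (conj τ - τ) = -2 i β Im τ`, which is real only if
  -- `Re β = 0`.
  have e2 : β.re = 0 := by
    have : ∑ σ : R, a σ * (starRingEnd ℂ) ((σ : Site k) : ℂ)
        = α + β * (starRingEnd ℂ) k.tau := by
      rw [hα, hβ, Finset.sum_mul, ← Finset.sum_add_distrib]
      refine Finset.sum_congr rfl fun σ _ => ?_
      rw [hσ, Complex.real_smul, Complex.real_smul]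
      simp only [map_add, map_mul, Complex.conj_ofReal]; ring
    rw [this, e1] at h2
    simp at h2
    have h3 : β.re * k.tau.im = 0 := by linarith
    exact (mul_eq_zero.1 h3).resolve_right k.tau_im_pos.ne'
  rw [← Submodule.Quotient.mk_eq_zero, ← Submodule.mkQ_apply, map_sum]
  have s1 : ∀ σ : R, (bddForces R).mkQ (divBond (σ : Site k) (imInv xhat (a σ)))
      = (bddForces R).mkQ (divBond (siteEquiv k (1, 0)) (imInvL xhat (m σ • a σ)))
        + (bddForces R).mkQ (divBond (siteEquiv k (0, 1)) (imInvL xhat (n σ • a σ))) := by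
    intro σ
    have := mkQ_divBond_siteEquiv hR (summable_divBond_imInv xhat (a σ))
      ((siteEquiv k).symm σ)
    rw [AddEquiv.apply_symm_apply] at this
    rw [this]
    simp only [map_smul]
    rfl
  rw [Finset.sum_congr rfl fun σ _ => s1 σ, Finset.sum_add_distrib]
  simp only [← map_sum]
  rw [← hα, ← hβ]
  have c1 : imInvL xhat α
      = (-β.im) • fun x : Site k => (((siteEquiv k (0, 1) : Site k) : ℂ) / rel xhat x).re := by
    funext x
    change (α * (rel xhat x)⁻¹).im = -β.im * _
    rw [e1, siteEquiv_coe]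
    have : (-β * k.tau * (rel xhat x)⁻¹).im = -(β * (k.tau / rel xhat x)).im := by
      rw [← Complex.neg_im]; congr 1; ring
    rw [this, Complex.mul_im, e2]
    simp
  have c2 : imInvL xhat β
      = β.im • fun x : Site k => (((siteEquiv k (1, 0) : Site k) : ℂ) / rel xhat x).re := by
    funext x
    change (β * (rel xhat x)⁻¹).im = β.im * _
    rw [siteEquiv_coe, Complex.mul_im, e2]
    simp
  rw [c1, c2]
  simp only [map_smul]
  rw [mkQ_divBond_cauchyRiemann hR hx (siteEquiv k (0, 1)) (siteEquiv k (1, 0))]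
  rw [neg_smul, neg_add_cancel]

end Linear

/-! ### The residual of the predictor -/

section Residual

open Asymptotics

variable {R : Finset (Site k)}

theorem coe_toIcoMod_arg (z : ℂ) : ((argCut z : ℝ) : Real.Angle) = (z.arg : Real.Angle) := by
  rw [argCut, Real.Angle.angle_eq_iff_two_pi_dvd_sub]
  refine ⟨-toIcoDiv Real.two_pi_pos 0 z.arg, ?_⟩
  have := toIcoMod_add_toIcoDiv_zsmul Real.two_pi_pos 0 z.arg
  rw [zsmul_eq_mul] at this
  push_cast
  linarith

/-- The elastic strain of the far-field predictor, obtained without a branch cut. -/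
def elasticStrain (R : Finset (Site k)) (b : ℝ) (xhat : ℂ) (x : Site k) : EuclideanSpace ℝ R :=
  WithLp.toLp 2 fun ρ => b / (2 * Real.pi) * (Complex.log (1 + (ρ : Site k) / rel xhat x)).im

/-- A difference of arguments equals the argument of the quotient modulo `2 π`. After scaling, the
jump is an integer multiple of `b = ±p`, hence a slip. -/
theorem exists_grad_uHat_eq {b p : ℝ} (hb : b = p ∨ b = -p) {xhat : ℂ} (hx : xhat ∉ lattice k)
    (x : Site k) :
    ∃ n : R → ℤ, grad R (uHat b xhat) x = elasticStrain R b xhat x + slip R p n := by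
  have hz : ∀ x : Site k, rel xhat x ≠ 0 := fun x h => hx (by
    rw [← sub_eq_zero.1 h]; exact x.2)
  have key : ∀ ρ : R, ∃ n : ℤ, uHat b xhat (x + (ρ : Site k)) - uHat b xhat x
      = b / (2 * Real.pi) * (Complex.log (1 + (ρ : Site k) / rel xhat x)).im + n * p := by
    intro ρ
    have h1 : 1 + ((ρ : Site k) : ℂ) / rel xhat x = rel xhat (x + (ρ : Site k)) / rel xhat x := by
      rw [rel_add, add_div, div_self (hz x)]
    have h2 : ((argCut (rel xhat (x + (ρ : Site k))) - argCut (rel xhat x) : ℝ) : Real.Angle)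
        = ((rel xhat (x + (ρ : Site k)) / rel xhat x).arg : Real.Angle) := by
      rw [Real.Angle.coe_sub, coe_toIcoMod_arg, coe_toIcoMod_arg,
        Complex.arg_div_coe_angle (hz _) (hz _)]
    rw [Real.Angle.angle_eq_iff_two_pi_dvd_sub] at h2
    obtain ⟨n, hn⟩ := h2
    have h3 : uHat b xhat (x + (ρ : Site k)) - uHat b xhat x
        = b / (2 * Real.pi) * (rel xhat (x + (ρ : Site k)) / rel xhat x).arg + n * b := by
      change b / (2 * Real.pi) * argCut (rel xhat (x + (ρ : Site k)))
        - b / (2 * Real.pi) * argCut (rel xhat x) = _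
      rw [← mul_sub, sub_eq_iff_eq_add.1 hn]
      field_simp
      ring
    rw [Complex.log_im, h1]
    rcases hb with rfl | rfl
    · exact ⟨n, h3⟩
    · exact ⟨-n, by rw [h3]; push_cast; ring⟩
  choose n hn using key
  refine ⟨n, ?_⟩
  ext ρ
  simpa [grad, elasticStrain, slip] using hn ρ

theorem isBigO_norm_of_components {f : Site k → EuclideanSpace ℝ R} {g : Site k → ℝ}
    (h : ∀ ρ, (fun x => f x ρ) =O[cofinite] g) : f =O[cofinite] g := by
  have h1 : (fun x => ∑ ρ : R, ‖f x ρ‖) =O[cofinite] g :=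
    IsBigO.fun_sum fun ρ _ => (h ρ).norm_left
  refine (IsBigO.of_bound 1 (Eventually.of_forall fun x => ?_)).trans h1
  classical
  rw [one_mul, Real.norm_of_nonneg (by positivity)]
  have : f x = ∑ ρ : R, EuclideanSpace.single ρ (f x ρ) := by
    ext σ; simp [Pi.single_apply]
  conv_lhs => rw [this]
  refine (norm_sum_le _ _).trans (le_of_eq ?_)
  simp

/-- The leading term of the elastic strain. -/
def leadingStrain (R : Finset (Site k)) (b : ℝ) (xhat : ℂ) (x : Site k) : EuclideanSpace ℝ R :=
  WithLp.toLp 2 fun ρ => b / (2 * Real.pi) * imInv xhat (ρ : Site k) x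

theorem isBigO_elasticStrain_sub (b : ℝ) (xhat : ℂ) :
    (fun x => elasticStrain R b xhat x - leadingStrain R b xhat x)
      =O[cofinite] fun x => ‖rel xhat x‖⁻¹ ^ 2 := by
  refine isBigO_norm_of_components fun ρ => ?_
  refine ((isBigO_im (isBigO_log_sub xhat (ρ : Site k))).const_mul_left
    (b / (2 * Real.pi))).congr_left fun x => ?_
  simp only [elasticStrain, leadingStrain, PiLp.sub_apply, imInv, Complex.sub_im, div_eq_mul_inv]
  ring

theorem isBigO_leadingStrain (b : ℝ) (xhat : ℂ) :
    (leadingStrain R b xhat) =O[cofinite] fun x => ‖rel xhat x‖⁻¹ := by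
  refine isBigO_norm_of_components fun ρ => ?_
  exact (isBigO_im (isBigO_div_rel xhat (ρ : Site k))).const_mul_left (b / (2 * Real.pi))

theorem isBigO_inv_sq_inv (xhat : ℂ) :
    (fun x : Site k => ‖rel xhat x‖⁻¹ ^ 2) =O[cofinite] fun x => ‖rel xhat x‖⁻¹ := by
  refine IsBigO.of_bound 1 ?_
  filter_upwards [(tendsto_norm_rel xhat).eventually_ge_atTop 1] with x hx
  rw [Real.norm_of_nonneg (by positivity), Real.norm_of_nonneg (by positivity), one_mul, sq]
  exact mul_le_of_le_one_left (by positivity) (inv_le_one_of_one_le₀ hx)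

/-- The stress of the far-field predictor is, up to a square-summable error, the sum of a constant
and of the linear stress of the leading strain. -/
theorem isBigO_stress {V : EuclideanSpace ℝ R → ℝ} {M : ℝ} (hV : TaylorBounds V M) (b : ℝ)
    (xhat : ℂ) :
    (fun x => fderiv ℝ V (elasticStrain R b xhat x) - fderiv ℝ V 0
      - fderiv ℝ (fderiv ℝ V) 0 (leadingStrain R b xhat x))
      =O[cofinite] fun x => ‖rel xhat x‖⁻¹ ^ 2 := by
  have h1 := isBigO_elasticStrain_sub (R := R) b xhat
  have h2 : (elasticStrain R b xhat) =O[cofinite] fun x => ‖rel xhat x‖⁻¹ := by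
    have := (h1.trans (isBigO_inv_sq_inv xhat)).add (isBigO_leadingStrain (R := R) b xhat)
    exact this.congr_left fun x => sub_add_cancel _ _
  have h3 : (fun x => fderiv ℝ V (elasticStrain R b xhat x) - fderiv ℝ V 0
      - fderiv ℝ (fderiv ℝ V) 0 (elasticStrain R b xhat x))
      =O[cofinite] fun x => ‖rel xhat x‖⁻¹ ^ 2 := by
    refine (IsBigO.of_bound M (Eventually.of_forall fun x => ?_)).trans (h2.norm_left.pow 2)
    have := hV.fderiv_taylor_one 0 (elasticStrain R b xhat x)
    rw [zero_add] at this
    simpa using this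
  have h4 := (ContinuousLinearMap.isBigO_comp (fderiv ℝ (fderiv ℝ V) 0)
    (fun x => elasticStrain R b xhat x - leadingStrain R b xhat x) cofinite).trans h1
  refine (h3.add h4).congr_left fun x => ?_
  rw [map_sub]
  abel

open scoped Classical in
-- Modulo `ℓ²` the stress changes neither when `w` is dropped nor when `V'` is linearised at `0`,
-- and slips leave it unchanged. The constant stress has zero divergence, and the linear part is
-- covered by `sum_divBond_imInv_mem`.
theorem sum_divBond_stress_mem {V : EuclideanSpace ℝ R → ℝ} {b : ℝ} {xhat : ℂ}
    (hmodel : IsScrewModel R V b xhat) {M : ℝ} (hV : TaylorBounds V M) (w : HDot R)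
    {uPred : Site k → ℝ} (hPred : ∀ x, uPred x = uHat b xhat x + w.1 x) :
    ∑ σ : R, divBond (σ : Site k)
      (fun x => fderiv ℝ V (grad R uPred x) (EuclideanSpace.single σ 1)) ∈ bddForces R := by
  obtain ⟨p, ⟨⟨-, hslip⟩, -⟩, hb⟩ := hmodel.burgers
  have hR := hmodel.span_eq_top
  have hx := hmodel.core_notMem
  have hgrad : ∀ x, grad R uPred x = grad R (uHat b xhat) x + grad R w.1 x := by
    intro x
    have : uPred = uHat b xhat + w.1 := funext hPred
    rw [this, grad_add]; rfl
  have hper : ∀ x, fderiv ℝ V (grad R (uHat b xhat) x)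
      = fderiv ℝ V (elasticStrain R b xhat x) := by
    intro x
    obtain ⟨n, hn⟩ := exists_grad_uHat_eq (R := R) hb hx x
    rw [hn, fderiv_add_slip hslip.add_slip]
  have hlin : ∑ σ : R, divBond (σ : Site k) (imInv xhat (stressCoeff V σ)) ∈ bddForces R :=
    sum_divBond_imInv_mem hR hx (sum_stressCoeff_mul hV.contDiff hmodel.rotation)
      (im_sum_stressCoeff_mul_conj hV.contDiff)
  have hsingle : ∀ (ψ : EuclideanSpace ℝ R →L[ℝ] ℝ) (σ : R),
      ‖ψ (EuclideanSpace.single σ 1)‖ ≤ ‖ψ‖ := by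
    intro ψ σ
    simpa using ψ.le_opNorm (EuclideanSpace.single σ 1)
  have hlead : ∀ (x : Site k) (σ : R), fderiv ℝ (fderiv ℝ V) 0 (leadingStrain R b xhat x)
      (EuclideanSpace.single σ 1) = b / (2 * Real.pi) * imInv xhat (stressCoeff V σ) x := by
    intro x σ
    have e : leadingStrain R b xhat x = ∑ ρ : R,
        (b / (2 * Real.pi) * imInv xhat (ρ : Site k) x) • EuclideanSpace.single ρ (1 : ℝ) := by
      ext τ; simp [leadingStrain, Pi.single_apply]
    rw [e, map_sum]
    simp only [map_smul, sum_apply, smul_apply]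
    simp only [imInv, stressCoeff, Finset.sum_mul, Complex.im_sum, Finset.mul_sum]
    refine Finset.sum_congr rfl fun ρ _ => ?_
    rw [mul_assoc (coeff V ρ σ : ℂ), Complex.im_ofReal_mul, smul_eq_mul, coeff]
    ring
  have key : ∀ σ : R, (bddForces R).mkQ (divBond (σ : Site k)
      (fun x => fderiv ℝ V (grad R uPred x) (EuclideanSpace.single σ 1)))
      = (b / (2 * Real.pi)) • (bddForces R).mkQ
        (divBond (σ : Site k) (imInv xhat (stressCoeff V σ))) := by
    intro σ
    have s1 : Summable fun x => (fderiv ℝ V (grad R uPred x) (EuclideanSpace.single σ 1)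
        - fderiv ℝ V (grad R (uHat b xhat) x) (EuclideanSpace.single σ 1)) ^ 2 := by
      refine Summable.of_nonneg_of_le (fun x => sq_nonneg _) (fun x => ?_)
        ((lp_summable_sq (gradL R w)).mul_left (M ^ 2))
      rw [hgrad, ← sub_apply, ← sq_abs, ← mul_pow]
      exact pow_le_pow_left₀ (abs_nonneg _)
        ((hsingle _ _).trans (hV.fderiv_lip _ _)) 2
    have s2 : Summable fun x => (fderiv ℝ V (elasticStrain R b xhat x) (EuclideanSpace.single σ 1)
        - (fderiv ℝ V 0 (EuclideanSpace.single σ 1)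
          + b / (2 * Real.pi) * imInv xhat (stressCoeff V σ) x)) ^ 2 := by
      apply summable_sq_of_isBigO xhat
      refine (IsBigO.of_bound 1 (Eventually.of_forall fun x => ?_)).trans
        (isBigO_stress hV b xhat)
      rw [one_mul, ← hlead, ← sub_sub]
      exact hsingle (fderiv ℝ V (elasticStrain R b xhat x) - fderiv ℝ V 0
        - fderiv ℝ (fderiv ℝ V) 0 (leadingStrain R b xhat x)) σ
    rw [mkQ_divBond_eq_of_summable hR _ s1]
    simp only [hper]
    rw [mkQ_divBond_eq_of_summable hR _ s2, ← map_smul, ← map_smul]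
    congr 1
    funext x
    simp only [divBond_apply, Pi.smul_apply, smul_eq_mul]
    ring
  rw [← Submodule.Quotient.mk_eq_zero, ← Submodule.mkQ_apply, map_sum,
    Finset.sum_congr rfl fun σ _ => key σ, ← Finset.smul_sum, ← map_sum, Submodule.mkQ_apply,
    (Submodule.Quotient.mk_eq_zero _).2 hlin, smul_zero]

/-- The first variation of the energy at the predictor extends to a bounded functional on the
energy space. -/
theorem exists_firstVariation {V : EuclideanSpace ℝ R → ℝ} {b : ℝ} {xhat : ℂ}
    (hmodel : IsScrewModel R V b xhat) {M : ℝ} (hV : TaylorBounds V M) (w : HDot R)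
    {uPred : Site k → ℝ} (hPred : ∀ x, uPred x = uHat b xhat x + w.1 x) :
    ∃ L : HDot R →L[ℝ] ℝ, ∀ v ∈ Hc R,
      L v = ∑' x, fderiv ℝ V (grad R uPred x) (grad R v.1 x) := by
  classical
  obtain ⟨C, hC, hbd⟩ := sum_divBond_stress_mem hmodel hV w hPred
  have hsum : ∀ {v : HDot R}, v ∈ Hc R →
      Summable fun x => fderiv ℝ V (grad R uPred x) (grad R v.1 x) := fun {v} hv =>
    summable_of_hasFiniteSupport
      ((grad_support_finite (R := R) hv).subset fun x hx hx' => hx (by simp [hx']))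
  have heq : ∀ v ∈ Hc R, ∑' x, fderiv ℝ V (grad R uPred x) (grad R v.1 x)
      = ∑' x, (∑ σ : R, divBond (σ : Site k)
        (fun x => fderiv ℝ V (grad R uPred x) (EuclideanSpace.single σ 1))) x * v.1 x := by
    intro v hv
    simp only [Finset.sum_apply, Finset.sum_mul]
    rw [Summable.tsum_finsetSum fun σ _ => summable_mul_Hc R hv _]
    simp only [tsum_divBond_mul _ _ hv]
    rw [← Summable.tsum_finsetSum]
    · refine tsum_congr fun x => ?_
      have e : grad R v.1 x = ∑ σ : R, (v.1 (x + σ) - v.1 x) • EuclideanSpace.single σ (1 : ℝ) := by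
        ext τ; simp [grad, Pi.single_apply]
      conv_lhs => rw [e, map_sum]
      refine Finset.sum_congr rfl fun σ _ => ?_
      rw [map_smul, smul_eq_mul, mul_comm]
    · intro σ _
      refine summable_of_hasFiniteSupport ((grad_support_finite (R := R) hv).subset
        fun x hx hx' => hx ?_)
      have : grad R v.1 x σ = 0 := by rw [hx']; rfl
      have : v.1 (x + σ) - v.1 x = 0 := this
      simp only [this, mul_zero]
  let L₀ : H0Submodule R univ →ₗ[ℝ] ℝ :=
    { toFun := fun v => ∑' x, fderiv ℝ V (grad R uPred x) (grad R v.1.1 x)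
      map_add' := by
        intro u v
        rw [← (hsum (mem_Hc_iff.2 u.2)).tsum_add (hsum (mem_Hc_iff.2 v.2))]
        refine tsum_congr fun x => ?_
        rw [← map_add]
        exact congrArg _ (congrFun (grad_add R u.1.1 v.1.1) x)
      map_smul' := by
        intro t v
        rw [RingHom.id_apply, smul_eq_mul, ← tsum_mul_left]
        refine tsum_congr fun x => ?_
        rw [← smul_eq_mul, ← map_smul]
        exact congrArg _ (congrFun (grad_smul R t v.1.1) x) }
  let L₁ : StrongDual ℝ (H0Submodule R univ) := L₀.mkContinuous C fun v => by
    have hv := mem_Hc_iff.2 v.2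
    change ‖∑' x, fderiv ℝ V (grad R uPred x) (grad R v.1.1 x)‖ ≤ _
    rw [heq v.1 hv]
    exact hbd v.1 hv
  -- Hahn–Banach extends the functional without needing density of the compactly supported
  -- displacements.
  obtain ⟨L, hL, -⟩ := exists_extension_norm_eq (H0Submodule R univ) L₁
  exact ⟨L, fun v hv => hL ⟨v, mem_Hc_iff.1 hv⟩⟩

end Residual

/-! ### Minimisation over balls of the Galerkin spaces -/

section Minimise

variable {R : Finset (Site k)}

instance : Infinite (Site k) := (siteEquiv k).toEquiv.infinite_iff.1 inferInstance

/-- Such a `v` is constant and vanishes somewhere, the lattice being infinite. Hence the seminorm is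
a norm on compactly supported displacements. -/
theorem eq_zero_of_grad_eq_zero (hR : AddSubgroup.closure (R : Set (Site k)) = ⊤)
    {v : Site k → ℝ} (hv : v.support.Finite) (h : ∀ x, grad R v x = 0) : v = 0 := by
  obtain ⟨y, hy⟩ := hv.infinite_compl.nonempty
  have hy0 : v y = 0 := by simpa using hy
  funext x
  obtain ⟨C, K, _, hC⟩ := exists_abs_sub_le hR (x - y)
  have := hC v y 0 fun z _ => by simp [h]
  rw [mul_zero, add_sub_cancel, hy0, sub_zero] at this
  exact abs_nonpos_iff.1 this

open scoped Classical in
/-- Extension by zero of a function on a set of sites. -/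
def zeroExtension {Ω : Set (Site k)} (f : Ω → ℝ) (x : Site k) : ℝ :=
  if h : x ∈ Ω then f ⟨x, h⟩ else 0

theorem zeroExtension_of_mem {Ω : Set (Site k)} (f : Ω → ℝ) {x : Site k} (hx : x ∈ Ω) :
    zeroExtension f x = f ⟨x, hx⟩ := dif_pos hx

theorem zeroExtension_of_notMem {Ω : Set (Site k)} (f : Ω → ℝ) {x : Site k} (hx : x ∉ Ω) :
    zeroExtension f x = 0 := dif_neg hx

/-- Extension by zero as a linear map from the nodal values on a finite set to the energy
space. -/
def extendZero (R : Finset (Site k)) {Ω : Set (Site k)} (hΩ : Ω.Finite) :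
    (Ω → ℝ) →ₗ[ℝ] HDot R where
  toFun f := ofFinite R (zeroExtension f)
    (hΩ.subset fun _ hx => by_contra fun h => hx (zeroExtension_of_notMem f h))
  map_add' f g := Subtype.ext (funext fun x => by
    change zeroExtension (f + g) x = zeroExtension f x + zeroExtension g x
    unfold zeroExtension
    split_ifs <;> simp)
  map_smul' t f := Subtype.ext (funext fun x => by
    change zeroExtension (t • f) x = t * zeroExtension f x
    unfold zeroExtension
    split_ifs <;> simp)

theorem extendZero_of_mem {Ω : Set (Site k)} (hΩ : Ω.Finite) (f : Ω → ℝ) {x : Site k}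
    (hx : x ∈ Ω) : (extendZero R hΩ f).1 x = f ⟨x, hx⟩ := zeroExtension_of_mem f hx

theorem extendZero_of_notMem {Ω : Set (Site k)} (hΩ : Ω.Finite) (f : Ω → ℝ) {x : Site k}
    (hx : x ∉ Ω) : (extendZero R hΩ f).1 x = 0 := zeroExtension_of_notMem f hx

theorem extendZero_mem {Ω : Set (Site k)} (hΩ : Ω.Finite) (f : Ω → ℝ) :
    extendZero R hΩ f ∈ H0 R Ω := by
  have h0 : ∀ x ∉ Ω, (extendZero R hΩ f).1 x = 0 := fun x hx =>
    extendZero_of_notMem hΩ f hx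
  exact ⟨hΩ.subset fun x hx => by_contra fun h => hx (h0 x h), h0⟩

theorem extendZero_restrict {Ω : Set (Site k)} (hΩ : Ω.Finite) {v : HDot R} (hv : v ∈ H0 R Ω) :
    extendZero R hΩ (fun x => v.1 x) = v := by
  refine Subtype.ext (funext fun x => ?_)
  by_cases h : x ∈ Ω
  · exact extendZero_of_mem hΩ _ h
  · exact (extendZero_of_notMem hΩ _ h).trans (hv.2 x h).symm

theorem exists_isMinOn_ball (hR : AddSubgroup.closure (R : Set (Site k)) = ⊤) {Ω : Set (Site k)}
    (hΩ : Ω.Finite) {E : HDot R → ℝ} (hE : Continuous E) {c : HDot R} (hc : c ∈ H0 R Ω) {δ : ℝ}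
    (hδ : 0 ≤ δ) :
    ∃ m ∈ H0 R Ω, ‖m - c‖ ≤ δ ∧ ∀ v ∈ H0 R Ω, ‖v - c‖ ≤ δ → E m ≤ E v := by
  have := hΩ.fintype
  set T := extendZero R hΩ with hT
  have hTc : Continuous T := T.continuous_of_finiteDimensional
  have hker : LinearMap.ker ((gradL R).comp T) = ⊥ := by
    rw [LinearMap.ker_eq_bot']
    intro f hf
    have h1 : ∀ x, grad R (T f).1 x = 0 := fun x => congrFun (congrArg Subtype.val hf) x
    have h2 := eq_zero_of_grad_eq_zero hR (extendZero_mem (R := R) hΩ f).1 h1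
    funext x
    exact (extendZero_of_mem hΩ f x.2).symm.trans (congrFun h2 x.1)
  -- An injective linear map on a finite-dimensional space is bounded below, so energy balls are
  -- bounded, hence compact, in nodal values.
  obtain ⟨K, -, hK⟩ := LinearMap.exists_antilipschitzWith _ hker
  have hcompact : IsCompact {f : Ω → ℝ | ‖T f - c‖ ≤ δ} := by
    refine Metric.isCompact_of_isClosed_isBounded ?_ ?_
    · exact isClosed_le (hTc.sub continuous_const).norm continuous_const
    · refine (Metric.isBounded_closedBall (x := (0 : Ω → ℝ)) (r := K * (δ + ‖c‖))).subset ?_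
      intro f hf
      have h1 := hK.le_mul_dist f 0
      rw [map_zero, dist_zero_right, dist_zero_right] at h1
      rw [mem_closedBall_zero_iff]
      refine h1.trans (mul_le_mul_of_nonneg_left ?_ K.2)
      change ‖T f‖ ≤ _
      have h2 : ‖T f - c‖ ≤ δ := hf
      have h3 := norm_sub_norm_le (T f) c
      linarith
  have hne : {f : Ω → ℝ | ‖T f - c‖ ≤ δ}.Nonempty :=
    ⟨fun x => c.1 x, by
      change ‖T _ - c‖ ≤ δ
      rw [hT, extendZero_restrict hΩ hc, sub_self, norm_zero]
      exact hδ⟩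
  obtain ⟨f, hf, hmin⟩ := hcompact.exists_isMinOn hne (hE.comp hTc).continuousOn
  refine ⟨T f, extendZero_mem hΩ f, hf, fun v hv hvc => ?_⟩
  have h1 := hmin (a := fun x => v.1 x) (by
    change ‖T _ - c‖ ≤ δ
    rw [hT, extendZero_restrict hΩ hv]
    exact hvc)
  have h2 : T (fun x => v.1 x) = v := extendZero_restrict hΩ hv
  simpa [h2] using h1

/-- A strongly stable critical point that is well approximated in a Galerkin space is close to a
stable local minimiser in that space. -/
theorem exists_galerkin_minimiser (hR : AddSubgroup.closure (R : Set (Site k)) = ⊤)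
    {V : EuclideanSpace ℝ R → ℝ} {M : ℝ} (hV : TaylorBounds V M)
    (g : Site k → EuclideanSpace ℝ R) (L : HDot R →L[ℝ] ℝ) {u : HDot R} {c : ℝ} (hc : 0 < c)
    (hcrit : ∀ v ∈ Hc R, extEnergyD V g L u v = 0)
    (hstab : ∀ v ∈ Hc R, c * ‖v‖ ^ 2 ≤ extEnergyH V g u v v)
    {Ω : Set (Site k)} (hΩ : Ω.Finite) {a : HDot R} (ha : a ∈ H0 R Ω) {η : ℝ} (hη : 0 < η)
    (hau : ‖a - u‖ ≤ η) (hsmall : M * ((8 * M / c + 2) * η) ≤ c / 8) :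
    ∃ m ∈ H0 R Ω, IsLocalMinOn (extEnergy V g L) (H0 R Ω) m ∧
      (∀ v ∈ H0 R Ω, c / 2 * ‖v‖ ^ 2 ≤ extEnergyH V g m v v) ∧
      ‖m - u‖ ≤ (8 * M / c + 2) * η := by
  have hM := hV.pos
  have hstab' : ∀ (m v : HDot R), v ∈ Hc R → (c - M * ‖m - u‖) * ‖v‖ ^ 2 ≤ extEnergyH V g m v v := by
    intro m v hv
    have h1 := norm_extEnergyH_sub_le g hV u (m - u) v v
    rw [add_sub_cancel, Real.norm_eq_abs] at h1
    have h2 := (abs_le.1 h1).1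
    have h3 := hstab v hv
    nlinarith
  -- Chosen so that `8 M η + c η = c δ`: the force term `M η δ` is then strictly less than `c δ² /
  -- 8`.
  set δ := (8 * M / c + 1) * η with hδ
  have hδ0 : 0 < δ := by positivity
  have hδη : δ + η = (8 * M / c + 2) * η := by rw [hδ]; ring
  rw [← hδη] at hsmall ⊢
  have hcδ : 8 * M * η + c * η = c * δ := by rw [hδ]; field_simp
  obtain ⟨m, hm, hma, hmin⟩ := exists_isMinOn_ball hR hΩ (continuous_extEnergy g L hV) ha hδ0.le
  have hmu : ‖m - u‖ ≤ δ + η := by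
    calc ‖m - u‖ = ‖(m - a) + (a - u)‖ := by rw [sub_add_sub_cancel]
      _ ≤ _ := (norm_add_le _ _).trans (add_le_add hma hau)
  have hlt : ‖m - a‖ < δ := by
    -- On the sphere the quadratic term is at least `7 c δ² / 16`, while the force at `a` and the
    -- cubic error cost at most `c δ² / 8` each. The energy would exceed its value at `a`,
    -- contradicting minimality.
    refine lt_of_le_of_ne hma fun heq => ?_
    have hd : m - a ∈ Hc R := ((H0Submodule R Ω).sub_mem hm ha).1
    have h1 := norm_extEnergy_taylor_two g L hV a (m - a)
    rw [add_sub_cancel, Real.norm_eq_abs, heq] at h1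
    have h1' := (abs_le.1 h1).1
    have h2 := norm_extEnergyD_sub_le g L hV u (a - u) (m - a)
    rw [add_sub_cancel, hcrit _ hd, sub_zero, Real.norm_eq_abs, heq] at h2
    have h2' := (abs_le.1 h2).1
    have h3 := hstab' a (m - a) hd
    rw [heq] at h3
    have h4 := hmin a ha (by simpa using hδ0.le)
    have h5 : M * (‖a - u‖ * δ) ≤ M * (η * δ) := by gcongr
    have h6 : M * ‖a - u‖ ≤ c / 8 := by
      refine le_trans ?_ hsmall
      gcongr
      linarith
    have h7 : M * δ ≤ c / 8 := by
      refine le_trans ?_ hsmall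
      gcongr
      linarith
    have h8 : M * δ ^ 3 ≤ c / 8 * δ ^ 2 := by
      calc M * δ ^ 3 = M * δ * δ ^ 2 := by ring
        _ ≤ _ := by gcongr
    have h9 : (c - c / 8) * δ ^ 2 ≤ (c - M * ‖a - u‖) * δ ^ 2 := by gcongr
    have h10 : 8 * (M * (η * δ)) + c * (η * δ) = c * δ ^ 2 := by
      linear_combination δ * hcδ
    have h11 : 0 < c * (η * δ) := by positivity
    have h12 : 0 < c * δ ^ 2 := by positivity
    linarith
  refine ⟨m, hm, ?_, fun v hv => ?_, hmu⟩
  · have hopen : {v : HDot R | ‖v - a‖ < δ} ∈ 𝓝 m :=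
      (isOpen_lt (continuous_id.sub continuous_const).norm continuous_const).mem_nhds hlt
    filter_upwards [mem_nhdsWithin_of_mem_nhds hopen, self_mem_nhdsWithin] with v hv hv'
    exact hmin v hv' (le_of_lt hv)
  · refine le_trans ?_ (hstab' m v hv.1)
    have h6 : M * ‖m - u‖ ≤ c / 8 := by
      refine le_trans ?_ hsmall
      gcongr
    gcongr
    linarith

theorem tendsto_truncRate {s : ℝ} (hs : 1 < s) (r : ℕ) :
    Tendsto (truncRate s r) atTop (𝓝 0) := by
  have h := (isLittleO_log_rpow_rpow_atTop (r : ℝ) (show 0 < s - 1 by linarith)).tendsto_div_nhds_zero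
  refine h.congr' ?_
  filter_upwards [eventually_gt_atTop 0] with x hx
  rw [truncRate, Real.rpow_natCast, div_eq_mul_inv, ← Real.rpow_neg hx.le, neg_sub, mul_comm]

end Minimise

end ScrewDislocation

end

/-! ### The convergence estimate. -/

theorem theorem3p1 {k : ScrewDislocation.LatticeKind}
    (R : Finset (ScrewDislocation.Site k)) (V : EuclideanSpace ℝ R → ℝ) (b : ℝ) (xhat : ℂ)
    (hmodel : ScrewDislocation.IsScrewModel R V b xhat)
    -- the predictor differs from the far-field predictor by an element of the energy space
    (uPred : ScrewDislocation.Site k → ℝ) (w : ScrewDislocation.HDot R)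
    (hPred : ∀ x, uPred x = ScrewDislocation.uHat b xhat x + w x)
    -- a strongly stable solution
    (u : ScrewDislocation.HDot R)
    (hmin : IsLocalMin (ScrewDislocation.energy R V uPred) u)
    (hstab : ∃ c : ℝ, 0 < c ∧ ∀ v ∈ ScrewDislocation.Hc R,
      c * ‖v‖ ^ 2 ≤
        ScrewDislocation.secondVariation (ScrewDislocation.energy R V uPred) u v)
    -- decay of its strain
    (s : ℝ) (hs : 1 < s) (r : ℕ) (hr : r = 0 ∨ r = 1)
    (hdecay : ∃ C₀ r₀ : ℝ, ∀ x : ScrewDislocation.Site k, r₀ ≤ ‖(x : ℂ)‖ →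
      ‖ScrewDislocation.grad R u x‖ ≤ C₀ * ‖(x : ℂ)‖ ^ (-s) * Real.log ‖(x : ℂ)‖ ^ r) :
    ∃ C R₀ c : ℝ, 0 < C ∧ 0 < R₀ ∧ 0 < c ∧
      ∀ ρ : ℝ, R₀ < ρ → ∀ Ω : Set (ScrewDislocation.Site k), Ω.Finite →
        (∀ x : ScrewDislocation.Site k, ‖(x : ℂ)‖ < ρ → x ∈ Ω) →
        ∃ uR ∈ ScrewDislocation.H0 R Ω,
          IsLocalMinOn (ScrewDislocation.energy R V uPred) (ScrewDislocation.H0 R Ω) uR ∧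
          (∀ v ∈ ScrewDislocation.H0 R Ω, c * ‖v‖ ^ 2 ≤
            ScrewDislocation.secondVariation (ScrewDislocation.energy R V uPred) uR v) ∧
          ‖uR - u‖ ≤ C * ρ ^ (1 - s) * Real.log ρ ^ r := by
  obtain ⟨p, ⟨⟨hp, hslip⟩, -⟩, -⟩ := hmodel.burgers
  obtain ⟨M, hV⟩ := ScrewDislocation.exists_taylorBounds hmodel.contDiff hp hslip
  obtain ⟨L, hL⟩ := ScrewDislocation.exists_firstVariation hmodel hV w hPred
  obtain ⟨c, hc, hstab⟩ := hstab
  obtain ⟨C, R₁, hC, hR₁, htrunc⟩ :=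
    ScrewDislocation.exists_truncation hmodel.span_eq_top u hs r hdecay
  have hM := hV.pos
  set K := 8 * M / c + 2 with hK
  have hK0 : 0 < K := by positivity
  have hrate := ScrewDislocation.tendsto_truncRate hs r
  -- The energy at `u` is defined by extension, so it can be identified with `extEnergy` only on
  -- this closure; truncation places `u` there.
  have hclos : u ∈ closure (ScrewDislocation.Hc R) := by
    rw [Metric.mem_closure_iff]
    intro ε hε
    have h1 : ∀ᶠ ρ in atTop, C * ScrewDislocation.truncRate s r ρ < ε := by
      have := hrate.const_mul C
      rw [mul_zero] at this
      exact this.eventually_lt_const hε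
    obtain ⟨ρ, h2, h3⟩ := (h1.and (eventually_ge_atTop R₁)).exists
    obtain ⟨v, hv, -, hvu⟩ := htrunc ρ h3
    exact ⟨v, hv, by rw [dist_comm, dist_eq_norm]; exact hvu.trans_lt h2⟩
  have hsec : ∀ v ∈ ScrewDislocation.Hc R, c * ‖v‖ ^ 2 ≤
      ScrewDislocation.extEnergyH V (ScrewDislocation.grad R uPred) u v v := fun v hv => by
    rw [← ScrewDislocation.secondVariation_energy hV hL hclos hv]
    exact hstab v hv
  have hcrit : ∀ v ∈ ScrewDislocation.Hc R,
      ScrewDislocation.extEnergyD V (ScrewDislocation.grad R uPred) L u v = 0 := fun v hv =>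
    ScrewDislocation.extEnergyD_eq_zero_of_isLocalMin hV hL hclos hv hmin
  -- As `s > 1` the rate tends to zero. This threshold keeps the whole minimisation ball in the
  -- region where the second variation at `u` controls nearby ones.
  have hsmall : ∀ᶠ ρ in atTop, M * (K * (C * ScrewDislocation.truncRate s r ρ)) < c / 8 := by
    have := ((hrate.const_mul C).const_mul K).const_mul M
    simp only [mul_zero] at this
    exact this.eventually_lt_const (by positivity)
  obtain ⟨R₂, hR₂⟩ := eventually_atTop.1 hsmall
  refine ⟨K * C, max R₁ R₂, c / 2, by positivity, by positivity, by positivity,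
    fun ρ hρ Ω hΩ hball => ?_⟩
  have hρ₁ : R₁ ≤ ρ := (le_max_left _ _).trans hρ.le
  have hρ₂ : R₂ ≤ ρ := (le_max_right _ _).trans hρ.le
  obtain ⟨a, haHc, hasupp, hau⟩ := htrunc ρ hρ₁
  have ha : a ∈ ScrewDislocation.H0 R Ω :=
    ⟨haHc, fun x hx => hasupp x (not_lt.1 fun h => hx (hball x h))⟩
  have hη : 0 < C * ScrewDislocation.truncRate s r ρ :=
    mul_pos hC (ScrewDislocation.truncRate_pos (by linarith))
  obtain ⟨m, hm, hmmin, hmstab, hmu⟩ := ScrewDislocation.exists_galerkin_minimiser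
    hmodel.span_eq_top hV (ScrewDislocation.grad R uPred) L hc hcrit hsec hΩ ha hη hau
    (hR₂ ρ hρ₂).le
  refine ⟨m, hm, ?_, fun v hv => ?_, hmu.trans (le_of_eq ?_)⟩
  · filter_upwards [hmmin, self_mem_nhdsWithin] with v hv hv'
    rw [ScrewDislocation.energy_eq_extEnergy hV hL (subset_closure hm.1),
      ScrewDislocation.energy_eq_extEnergy hV hL (subset_closure hv'.1)]
    exact hv
  · rw [ScrewDislocation.secondVariation_energy hV hL (subset_closure hm.1) hv.1]
    exact hmstab v hv
  · rw [ScrewDislocation.truncRate, ← hK]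
    ring
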